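/- **Setting.** Let $N\ge 1$ be an even integer, $h=\sqrt2\,N^{-1/2}$, $A_h=h\mathbb Z\cap[-\tfrac1h,\tfrac1h]$, $\|u\|_{\ell^2(h\mathbb Z)}^2=h\sum_{a\in h\mathbb Z}|u(a)|^2$, and $(\pi_h g)(a)=g(a)$ for $a\in h\mathbb Z$. Let $\psi_n(x)=\pi^{-1/4}2^{-n/2}(n!)^{-1/2}e^{-x^2/2}H_n(x)$ be the Hermite functions, where $H_0=1$, $H_{n+1}=2xH_n-2nH_{n-1}$; they satisfy $H\psi_n=(2n+1)\psi_n$ for $H=-\partial_x^2+x^2$. Define $k_{0,h}=1$, $k_{n+1,h}(x)=2x\,k_{n,h}(x)-2n\bigl(1-h^2\tfrac{n-1}{2}\bigr)k_{n-1,h}(x)$ (with $k_{-1,h}=0$), and for $0\le n\le N$ the Kravchuk functions on $h\mathbb Z$ $$\varphi_{n,h}(a)=\frac1{h^n}\sqrt{\frac{(N-n)!}{N!\,n!}}\;k_{n,h}(a)\sqrt{\rho_h(a)},\qquad \rho_h(a)=\frac1{h2^N}\binom{N}{\frac N2+\frac ah}\ (a\in A_h),\quad \rho_h(a)=0\ (a\notin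 A_h).$$ Let $H_h$ be the operator on functions on $h\mathbb Z$ given by $$H_hu(a)=-\tfrac1{h^2}\sqrt{(1+ah+h^2)(1-ah)}\,u(a+h)-\tfrac1{h^2}\sqrt{(1-ah+h^2)(1+ah)}\,u(a-h)+\bigl(1+\tfrac2{h^2}\bigr)u(a)$$ for $a\in A_h$, and $H_hu(a)=0$ for $a\in h\mathbb Z\setminus A_h$. Let $f:\mathbb R\to\mathbb C$ be smooth in the sense that $f\in C^\infty$, $f^{(k)}\in L^2(\mathbb R)$ and $(1+x^2)^{k/2}f\in L^2(\mathbb R)$ for all $k\in\mathbb N$. Put $$\psi(t)=e^{-itH}f=\sum_{n\ge0}c_n e^{-i(2n+1)t}\psi_n,\quad c_n=\int_{\mathbb R} f\psi_n,\qquad \psi_h(t)=\sum_{n=0}^{n_{\max}}c_{n,h}e^{-i(2n+1)t}\varphi_{n,h},\quad c_{n,h}=h\sum_{a\in A_h}f(a)\varphi_{n,h}(a).$$ **Theorem 4.** For every such $f$, the series defining $\psi(t,x)$ converges absolutely for all real $t,x$, and there is a constant $C$ such that for every $s\in\mathbb R$ there is a constant $C_s$ such that for every $\delta>0$ the following holds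 for all sufficiently small $h=\sqrt2\,N^{-1/2}$, $N$ even (how small may depend on $f$, $s$, $\delta$), and all $n_{\max}\in\mathbb N$ with $\tfrac14\delta|\log h|\le n_{\max}\le\tfrac13\delta|\log h|$: the function $\psi_h$ solves $i\partial_t\psi_h=H_h\psi_h$, and for all $t\ge0$, $\pi_h\psi(t)-\psi_h(t)\in\ell^2(h\mathbb Z)$ and $$\|\pi_h\psi(t)-\psi_h(t)\|_{\ell^2(h\mathbb Z)}\le C\,h^{2-\delta}+\frac{C_s}{|\log h|^{s}}.$$ -/

import Mathlib

open MeasureTheory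

noncomputable section

namespace Kravchuk

/-! ### The continuous harmonic oscillator -/

/-- Hermite polynomials: `H₀ = 1`, `H_{n+1} = 2 x H_n - 2 n H_{n-1}`. -/
def hermitePoly : ℕ → ℝ → ℝ
  | 0, _ => 1
  | 1, x => 2 * x
  | n + 2, x => 2 * x * hermitePoly (n + 1) x - 2 * ((n : ℝ) + 1) * hermitePoly n x

/-- `ψ_n(x) = π^{-1/4} 2^{-n/2} (n!)^{-1/2} e^{-x²/2} H_n(x)`. -/
def hermiteFun (n : ℕ) (x : ℝ) : ℝ :=
  1 / (Real.pi ^ (1 / 4 : ℝ) * (2 : ℝ) ^ ((n : ℝ) / 2) * √(n.factorial : ℝ))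
    * Real.exp (-x ^ 2 / 2) * hermitePoly n x

/-- `c_n(f) = ∫ f ψ_n`. -/
def hermiteCoeff (f : ℝ → ℂ) (n : ℕ) : ℂ := ∫ x : ℝ, f x * (hermiteFun n x : ℂ)

/-- The `n`-th term of the spectral expansion of `e^{-itH} f` at `x`, where `H = -∂ₓ² + x²`
and `H ψ_n = (2n+1) ψ_n`. -/
def evolutionTerm (f : ℝ → ℂ) (t x : ℝ) (n : ℕ) : ℂ :=
  hermiteCoeff f n * Complex.exp (-Complex.I * (2 * n + 1) * t) * (hermiteFun n x : ℂ)

/-- `ψ(t, x) = (e^{-itH} f)(x) = ∑ₙ c_n(f) e^{-i(2n+1)t} ψ_n(x)`. -/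
def evolution (f : ℝ → ℂ) (t x : ℝ) : ℂ := ∑' n : ℕ, evolutionTerm f t x n

/-- `f` belongs to every weighted Sobolev space
`Σⁿ = {g ∈ Hⁿ : ⟨x⟩ⁿ g ∈ L²}`, `⟨x⟩ = (1 + x²)^{1/2}`. As `⋂ Hⁿ(ℝ) ⊆ C^∞(ℝ)`, the function is
taken to be the smooth representative, and `Hⁿ` is expressed by classical derivatives. -/
structure IsSmooth (f : ℝ → ℂ) : Prop where
  contDiff : ContDiff ℝ (⊤ : ℕ∞) f
  memLp_deriv : ∀ k : ℕ, MemLp (iteratedDeriv k f) 2 volume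
  memLp_weight : ∀ k : ℕ, MemLp (fun x : ℝ => ((√(1 + x ^ 2) ^ k : ℝ) : ℂ) * f x) 2 volume

/-! ### The grid `hℤ` -/

/-- The grid `hℤ ⊆ ℝ`. -/
abbrev Grid (h : ℝ) : Type := AddSubgroup.zmultiples h

/-- The step `h`, as an element of `hℤ`. -/
def Grid.step (h : ℝ) : Grid h := ⟨h, AddSubgroup.mem_zmultiples h⟩

/-- Membership in `A_h = hℤ ∩ [-1/h, 1/h]`. -/
def InA (h : ℝ) (a : Grid h) : Prop := (a : ℝ) ∈ Set.Icc (-(1 / h)) (1 / h)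

/-- `u ∈ ℓ²(hℤ)`. -/
def MemEll2 (h : ℝ) (u : Grid h → ℂ) : Prop := Summable fun a => ‖u a‖ ^ 2

/-- `‖u‖_{ℓ²(hℤ)} = (h ∑_{a ∈ hℤ} |u(a)|²)^{1/2}`. -/
def ell2Norm (h : ℝ) (u : Grid h → ℂ) : ℝ := √(h * ∑' a : Grid h, ‖u a‖ ^ 2)

/-- `π_h g`: pointwise restriction to the grid. -/
def restrict (h : ℝ) (g : ℝ → ℂ) : Grid h → ℂ := fun a => g a

/-! ### Kravchuk functions and the Kravchuk oscillator -/

/-- `k_{0,h} = 1`, `k_{n+1,h} = 2 x k_{n,h} - 2 n (1 - h² (n-1)/2) k_{n-1,h}`. -/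
def kravchukPoly (h : ℝ) : ℕ → ℝ → ℝ
  | 0, _ => 1
  | 1, x => 2 * x
  | n + 2, x => 2 * x * kravchukPoly h (n + 1) x
      - 2 * ((n : ℝ) + 1) * (1 - h ^ 2 * ((n : ℝ) / 2)) * kravchukPoly h n x

open Classical in
/-- The rescaled binomial weight on `A_h`, extended by zero to `hℤ`. -/
def rho (h : ℝ) (a : Grid h) : ℝ :=
  if InA h a then
    1 / (h * (2 : ℝ) ^ (2 / h ^ 2)) *
      (Real.Gamma (1 + 2 / h ^ 2) /
        (Real.Gamma (1 + 1 / h ^ 2 + a / h) * Real.Gamma (1 + 1 / h ^ 2 - a / h)))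
  else 0

/-- The normalization constant `α_{n,h}`. -/
def alpha (n : ℕ) (h : ℝ) : ℝ :=
  1 / (h ^ n * √(n.factorial : ℝ)) *
    √(Real.Gamma (1 + 2 / h ^ 2 - n) / Real.Gamma (1 + 2 / h ^ 2))

/-- The Kravchuk function `φ_{n,h} = α_{n,h} k_{n,h} √ρ_h`. -/
def kravchukFun (n : ℕ) (h : ℝ) (a : Grid h) : ℝ :=
  alpha n h * kravchukPoly h n a * √(rho h a)

open Classical in
/-- The discrete Hamiltonian `H_h`. -/
def kravchukOscillator (h : ℝ) (u : Grid h → ℂ) (a : Grid h) : ℂ :=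
  if InA h a then
    -((1 / h ^ 2 * √((1 + a * h + h ^ 2) * (1 - a * h)) : ℝ) : ℂ) * u (a + Grid.step h)
      - ((1 / h ^ 2 * √((1 - a * h + h ^ 2) * (1 + a * h)) : ℝ) : ℂ) * u (a - Grid.step h)
      + ((1 + 2 / h ^ 2 : ℝ) : ℂ) * u a
  else 0

open Classical in
/-- `c_{n,h} = ⟨u, φ_{n,h}⟩_{ℓ²(hℤ)}` with `u = (π_h f) 1_{A_h}`. -/
def kravchukCoeff (f : ℝ → ℂ) (n : ℕ) (h : ℝ) : ℂ :=
  (h : ℂ) * ∑' a : Grid h, (if InA h a then restrict h f a else 0) * (kravchukFun n h a : ℂ)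

/-- `ψ_h(t) = ∑_{n ≤ nmax} c_{n,h} e^{-i(2n+1)t} φ_{n,h}`. -/
def discreteEvolution (f : ℝ → ℂ) (nmax : ℕ) (h t : ℝ) (a : Grid h) : ℂ :=
  ∑ n ∈ Finset.range (nmax + 1),
    kravchukCoeff f n h * Complex.exp (-Complex.I * (2 * n + 1) * t) * (kravchukFun n h a : ℂ)

/-- `Ψ` solves `i ∂ₜ Ψ = H_h Ψ` on `hℤ`. -/
def SolvesDiscreteSchrodinger (h : ℝ) (Ψ : ℝ → Grid h → ℂ) : Prop :=
  ∀ (t : ℝ) (a : Grid h),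
    HasDerivAt (fun τ => Ψ τ a) (-Complex.I * kravchukOscillator h (Ψ t) a) t

end Kravchuk

end

namespace Kravchuk

open SchwartzMap

/-! ### Hermite functions -/

/-! The Kravchuk functions are never compared with the Hermite functions one by one. Instead each
`ψ_m`, sampled on the grid, is treated as an approximate eigenvector of the discrete Hamiltonian
`H_h`: Taylor expansion gives `H_h ψ_m = (2m+1) ψ_m + r_m` on `A_h`, with `r_m` of size `h²` times a
power of `m + 1` (`consistency_bound`).

On `A_h` the operator `H_h` is symmetric with orthonormal eigenbasis `φ_{n,h}` and the same
eigenvalues `2n+1` as the continuous oscillator. Hence `⟨φ_n, r_m⟩ = (2n-2m) ⟨φ_n, ψ_m⟩`. The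
`φ_n`-coefficient of the evolution error of `ψ_m` is `(e_m - e_n) ⟨φ_n, ψ_m⟩`, with `e_n` unimodular
and replaced by `0` beyond the cutoff. It vanishes at `n = m ≤ nmax`, and otherwise `|e_m - e_n| ≤ 2
≤ |2n-2m|`. So the error on `A_h` is at most `‖r_m‖`, uniformly in time
(`norm_truncated_evolution_le`). For `m > nmax` the trivial bound `2‖ψ_m‖` is used, and outside
`A_h` only the tail of `ψ_m` survives, which is again small (`modeError_bound`).

A smooth `f` in the given sense is a Schwartz function (`IsSmooth.exists_schwartz`), so its Hermite
coefficients decay faster than any power and its Hermite series converges to it pointwise. By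
linearity the total error is the sum of the mode errors weighted by these coefficients. This gives
`O(h²)` plus an arbitrary negative power of `nmax + 1` (`evolution_error`). With `nmax` comparable
to `|log h|`, taking `h` small absorbs all constants. -/

theorem hasDerivAt_hermitePoly (n : ℕ) (x : ℝ) :
    HasDerivAt (hermitePoly n) (2 * n * hermitePoly (n - 1) x) x := by
  induction n using Nat.twoStepInduction with
  | zero => simpa [hermitePoly] using hasDerivAt_const x (1 : ℝ)
  | one => simpa [hermitePoly] using (hasDerivAt_id x).const_mul (2 : ℝ)
  | more n ih₀ ih₁ =>
    have h : HasDerivAt (fun y => 2 * y * hermitePoly (n + 1) y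
        - 2 * ((n : ℝ) + 1) * hermitePoly n y) _ x :=
      (((hasDerivAt_id x).const_mul 2).mul ih₁).sub (ih₀.const_mul (2 * ((n : ℝ) + 1)))
    refine h.congr_deriv ?_
    rcases n with _ | n
    · simp [hermitePoly]; ring
    · simp only [Nat.add_sub_cancel, id, hermitePoly]
      push_cast
      simp only [hermitePoly]
      ring

theorem hermiteConst_succ (n : ℕ) :
    1 / (Real.pi ^ (1 / 4 : ℝ) * (2 : ℝ) ^ ((n : ℝ) / 2) * √(n.factorial : ℝ)) =
      √(2 * ((n : ℝ) + 1)) * (1 / (Real.pi ^ (1 / 4 : ℝ) * (2 : ℝ) ^ (((n + 1 : ℕ) : ℝ) / 2)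
        * √((n + 1).factorial : ℝ))) := by
  have h1 : (2 : ℝ) ^ (((n + 1 : ℕ) : ℝ) / 2) = 2 ^ ((n : ℝ) / 2) * √2 := by
    rw [Real.sqrt_eq_rpow, ← Real.rpow_add (by norm_num)]
    push_cast; ring_nf
  have h2 : √((n + 1).factorial : ℝ) = √((n : ℝ) + 1) * √(n.factorial : ℝ) := by
    rw [Nat.factorial_succ, Nat.cast_mul, Real.sqrt_mul (by positivity)]; push_cast; rfl
  have h3 : √(2 * ((n : ℝ) + 1)) = √2 * √((n : ℝ) + 1) := Real.sqrt_mul (by norm_num) _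
  have : √((n : ℝ) + 1) ≠ 0 := by positivity
  have : √(n.factorial : ℝ) ≠ 0 := by positivity
  have : √(2 : ℝ) ≠ 0 := by positivity
  have : (2 : ℝ) ^ ((n : ℝ) / 2) ≠ 0 := by positivity
  have : Real.pi ^ (1 / 4 : ℝ) ≠ 0 := by positivity
  rw [h1, h2, h3]
  field_simp

theorem sqrt_two_mul_eq_two_mul_sqrt_half (y : ℝ) : √(2 * y) = 2 * √(y / 2) := by
  rw [show 2 * y = 2 ^ 2 * (y / 2) by ring, Real.sqrt_mul (by positivity),
    Real.sqrt_sq (by norm_num)]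

/-- The polynomial recurrence after normalization. At `n = 0` the truncated index `n - 1` is
harmless because its coefficient `√(0/2)` is zero. -/
theorem mul_hermiteFun (n : ℕ) (x : ℝ) :
    x * hermiteFun n x = √(((n : ℝ) + 1) / 2) * hermiteFun (n + 1) x
      + √((n : ℝ) / 2) * hermiteFun (n - 1) x := by
  rcases n with _ | n
  · have := hermiteConst_succ 0
    rw [sqrt_two_mul_eq_two_mul_sqrt_half] at this
    simp only [hermiteFun, hermitePoly, this]
    simp; ring
  · have h0 := hermiteConst_succ n
    have h1 := hermiteConst_succ (n + 1)
    rw [sqrt_two_mul_eq_two_mul_sqrt_half] at h0 h1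
    simp only [hermiteFun, Nat.add_sub_cancel, hermitePoly]
    rw [h0, h1]
    push_cast
    have e : √(((n : ℝ) + 1) / 2) * √(((n : ℝ) + 1) / 2) = ((n : ℝ) + 1) / 2 :=
      Real.mul_self_sqrt (by positivity)
    linear_combination (-4 * √(((n : ℝ) + 1 + 1) / 2) * (1 / (Real.pi ^ (1 / 4 : ℝ)
      * 2 ^ (((n : ℝ) + 1 + 1) / 2) * √((n + 1 + 1).factorial : ℝ))) * Real.exp (-x ^ 2 / 2)
      * hermitePoly n x) * e

theorem hasDerivAt_hermiteFun_lower (n : ℕ) (x : ℝ) :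
    HasDerivAt (hermiteFun n) (2 * √((n : ℝ) / 2) * hermiteFun (n - 1) x - x * hermiteFun n x) x := by
  have hg : HasDerivAt (fun y : ℝ => Real.exp (-y ^ 2 / 2)) (Real.exp (-x ^ 2 / 2) * (-x)) x := by
    have : HasDerivAt (fun y : ℝ => -y ^ 2 / 2) (-x) x := by
      have := ((hasDerivAt_pow 2 x).neg).div_const 2
      refine this.congr_deriv ?_
      simp; ring
    exact this.exp
  have h := ((hg.const_mul (1 / (Real.pi ^ (1 / 4 : ℝ) * (2 : ℝ) ^ ((n : ℝ) / 2)
    * √(n.factorial : ℝ)))).mul (hasDerivAt_hermitePoly n x))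
  refine h.congr_deriv ?_
  rcases n with _ | n
  · simp [hermiteFun]; ring
  · have h0 := hermiteConst_succ n
    rw [sqrt_two_mul_eq_two_mul_sqrt_half] at h0
    simp only [hermiteFun, Nat.add_sub_cancel]
    rw [h0]
    push_cast
    have e : √(((n : ℝ) + 1) / 2) * √(((n : ℝ) + 1) / 2) = ((n : ℝ) + 1) / 2 :=
      Real.mul_self_sqrt (by positivity)
    linear_combination (-4 * (1 / (Real.pi ^ (1 / 4 : ℝ)
      * 2 ^ (((n : ℝ) + 1) / 2) * √((n + 1).factorial : ℝ))) * Real.exp (-x ^ 2 / 2)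
      * hermitePoly n x) * e

theorem hasDerivAt_hermiteFun (n : ℕ) (x : ℝ) :
    HasDerivAt (hermiteFun n) (√((n : ℝ) / 2) * hermiteFun (n - 1) x
      - √(((n : ℝ) + 1) / 2) * hermiteFun (n + 1) x) x := by
  refine (hasDerivAt_hermiteFun_lower n x).congr_deriv ?_
  linear_combination - mul_hermiteFun n x

/-- Raising from `n` to `n + 1` and then lowering back to `n` leaves a multiple of `ψ_n`; this is
the eigenvalue equation. -/
theorem hasDerivAt_deriv_hermiteFun (n : ℕ) (x : ℝ) :
    HasDerivAt (deriv (hermiteFun n)) ((x ^ 2 - (2 * n + 1)) * hermiteFun n x) x := by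
  have e : deriv (hermiteFun n) = fun y => y * hermiteFun n y
      - 2 * √(((n : ℝ) + 1) / 2) * hermiteFun (n + 1) y := by
    ext y
    rw [(hasDerivAt_hermiteFun n y).deriv]
    linear_combination - mul_hermiteFun n y
  rw [e]
  have h1 := hasDerivAt_hermiteFun_lower (n + 1) x
  have h := ((hasDerivAt_id x).mul (hasDerivAt_hermiteFun n x)).sub
    (h1.const_mul (2 * √(((n : ℝ) + 1) / 2)))
  refine h.congr_deriv ?_
  simp only [Nat.add_sub_cancel, id]
  push_cast
  have e : √(((n : ℝ) + 1) / 2) * √(((n : ℝ) + 1) / 2) = ((n : ℝ) + 1) / 2 :=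
      Real.mul_self_sqrt (by positivity)
  linear_combination (-x) * mul_hermiteFun n x - 4 * hermiteFun n x * e

/-! ### Hermite functions as Schwartz functions, and the oscillator acting on them. -/

theorem exists_bound_polynomial_mul_gaussian (p : Polynomial ℝ) :
    ∃ C : ℝ, ∀ x : ℝ, |p.eval x * Real.exp (-(x ^ 2 / 2))| ≤ C := by
  induction p using Polynomial.induction_on' with
  | add p q hp hq =>
    obtain ⟨C, hC⟩ := hp
    obtain ⟨D, hD⟩ := hq
    refine ⟨C + D, fun x => ?_⟩
    rw [Polynomial.eval_add, add_mul]
    exact (abs_add_le _ _).trans (add_le_add (hC x) (hD x))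
  | monomial n a =>
    have hc : Continuous fun x : ℝ => x ^ n * Real.exp (-(x ^ 2 / 2)) := by fun_prop
    have ht : Filter.Tendsto (fun x : ℝ => x ^ n * Real.exp (-(x ^ 2 / 2)))
        (Filter.cocompact ℝ) (nhds 0) := by
      rw [tendsto_zero_iff_norm_tendsto_zero]
      refine (tendsto_rpow_abs_mul_exp_neg_mul_sq_cocompact (a := 1 / 2) (by norm_num) n).congr ?_
      intro x
      rw [norm_mul, norm_pow, Real.norm_eq_abs, Real.norm_eq_abs, Real.abs_exp, Real.rpow_natCast]
      ring_nf
    let F : ZeroAtInftyContinuousMap ℝ ℝ := ⟨⟨_, hc⟩, ht⟩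
    refine ⟨|a| * ‖F.toBCF‖, fun x => ?_⟩
    rw [Polynomial.eval_monomial, mul_assoc, abs_mul]
    exact mul_le_mul_of_nonneg_left (F.toBCF.norm_coe_le_norm x) (abs_nonneg a)

/-- The Gaussian `e^{-x²/2}` as a Schwartz function. -/
noncomputable def gaussianSchwartz : 𝓢(ℝ, ℂ) where
  toFun x := ((Real.exp (-(x ^ 2 / 2)) : ℝ) : ℂ)
  smooth' := Complex.ofRealCLM.contDiff.comp
    (show ContDiff ℝ _ fun x : ℝ => Real.exp (-(x ^ 2 / 2)) by fun_prop)
  decay' k n := by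
    obtain ⟨C, hC⟩ := exists_bound_polynomial_mul_gaussian
      (Polynomial.X ^ k * (Polynomial.hermite n).map (Int.castRingHom ℝ))
    refine ⟨C, fun x => ?_⟩
    have hg : ContDiffAt ℝ n (fun x : ℝ => Real.exp (-(x ^ 2 / 2))) x := by fun_prop
    have h1 := Complex.ofRealLI.norm_iteratedFDeriv_comp_left hg le_rfl
    have h2 : ‖iteratedFDeriv ℝ n (fun x : ℝ => ((Real.exp (-(x ^ 2 / 2)) : ℝ) : ℂ)) x‖
        = ‖iteratedFDeriv ℝ n (fun x : ℝ => Real.exp (-(x ^ 2 / 2))) x‖ := h1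
    rw [h2, norm_iteratedFDeriv_eq_norm_iteratedDeriv, iteratedDeriv_eq_iterate,
      Polynomial.deriv_gaussian_eq_hermite_mul_gaussian]
    refine le_trans (le_of_eq ?_) (hC x)
    simp only [Polynomial.eval_mul, Polynomial.eval_pow, Polynomial.eval_X, Polynomial.eval_map,
      Real.norm_eq_abs, abs_mul, abs_pow, abs_neg, abs_one, one_pow, one_mul, Polynomial.aeval_def,
      algebraMap_int_eq, mul_assoc]

theorem gaussianSchwartz_apply (x : ℝ) :
    gaussianSchwartz x = ((Real.exp (-(x ^ 2 / 2)) : ℝ) : ℂ) := rfl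

/-- Multiplication by the coordinate on the Schwartz space. -/
noncomputable def mulX : 𝓢(ℝ, ℂ) →L[ℝ] 𝓢(ℝ, ℂ) := smulLeftCLM ℂ (fun x : ℝ => x)

theorem mulX_apply (f : 𝓢(ℝ, ℂ)) (x : ℝ) : mulX f x = (x : ℂ) * f x := by
  rw [mulX, smulLeftCLM_apply_apply Function.HasTemperateGrowth.id']
  simp

theorem exists_schwartz_hermitePoly (n : ℕ) :
    ∃ F : 𝓢(ℝ, ℂ), ∀ x, F x = ((Real.exp (-(x ^ 2 / 2)) * hermitePoly n x : ℝ) : ℂ) := by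
  induction n using Nat.twoStepInduction with
  | zero => exact ⟨gaussianSchwartz, fun x => by simp [hermitePoly, gaussianSchwartz_apply]⟩
  | one =>
    refine ⟨(2 : ℝ) • mulX gaussianSchwartz, fun x => ?_⟩
    simp [hermitePoly, gaussianSchwartz_apply, mulX_apply]; ring
  | more n ih₀ ih₁ =>
    obtain ⟨F, hF⟩ := ih₀
    obtain ⟨G, hG⟩ := ih₁
    refine ⟨(2 : ℝ) • mulX G - (2 * ((n : ℝ) + 1)) • F, fun x => ?_⟩
    simp [hermitePoly, mulX_apply, hF, hG]; ring

theorem exists_schwartz_hermiteFun (n : ℕ) :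
    ∃ F : 𝓢(ℝ, ℂ), ∀ x, F x = (hermiteFun n x : ℂ) := by
  obtain ⟨F, hF⟩ := exists_schwartz_hermitePoly n
  refine ⟨(1 / (Real.pi ^ (1 / 4 : ℝ) * (2 : ℝ) ^ ((n : ℝ) / 2) * √(n.factorial : ℝ))) • F,
    fun x => ?_⟩
  rw [smul_apply, hF, hermiteFun, neg_div, Complex.real_smul, ← Complex.ofReal_mul, mul_assoc (1 / _)]

/-- The Hermite function `ψ_n` as a complex-valued Schwartz function. -/
noncomputable def hermiteSchwartz (n : ℕ) : 𝓢(ℝ, ℂ) := (exists_schwartz_hermiteFun n).choose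

theorem hermiteSchwartz_apply (n : ℕ) (x : ℝ) : hermiteSchwartz n x = (hermiteFun n x : ℂ) :=
  (exists_schwartz_hermiteFun n).choose_spec x

theorem deriv_hermiteSchwartz (n : ℕ) (x : ℝ) :
    deriv (hermiteSchwartz n) x = ((deriv (hermiteFun n) x : ℝ) : ℂ) := by
  have e : (hermiteSchwartz n : ℝ → ℂ) = fun x => (hermiteFun n x : ℂ) :=
    funext (hermiteSchwartz_apply n)
  rw [e, (hasDerivAt_hermiteFun n x).deriv]
  exact (hasDerivAt_hermiteFun n x).ofReal_comp.deriv

theorem deriv_deriv_hermiteSchwartz (n : ℕ) (x : ℝ) :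
    deriv (deriv (hermiteSchwartz n)) x = ((x : ℂ) ^ 2 - (2 * n + 1)) * hermiteSchwartz n x := by
  rw [funext (deriv_hermiteSchwartz n), (hasDerivAt_deriv_hermiteFun n x).ofReal_comp.deriv,
    hermiteSchwartz_apply]
  push_cast; rfl

theorem contDiff_hermiteFun (n : ℕ) : ContDiff ℝ (⊤ : ℕ∞) (hermiteFun n) := by
  have h := Complex.reCLM.contDiff.comp ((hermiteSchwartz n).smooth ⊤)
  have e : (Complex.reCLM ∘ (hermiteSchwartz n : ℝ → ℂ)) = hermiteFun n := by
    ext x; simp [hermiteSchwartz_apply]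
  rwa [e] at h

/-- The harmonic oscillator `-∂ₓ² + x²` on the Schwartz space. -/
noncomputable def oscillator (f : 𝓢(ℝ, ℂ)) : 𝓢(ℝ, ℂ) :=
  mulX (mulX f) - derivCLM ℝ ℂ (derivCLM ℝ ℂ f)

theorem oscillator_apply (f : 𝓢(ℝ, ℂ)) (x : ℝ) :
    oscillator f x = (x : ℂ) ^ 2 * f x - deriv (deriv f) x := by
  have : (derivCLM ℝ ℂ f : ℝ → ℂ) = deriv f := funext fun x => derivCLM_apply ℝ f x
  rw [oscillator, sub_apply, mulX_apply, mulX_apply, derivCLM_apply, this]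
  ring

theorem integrable_schwartz_mul (f g : 𝓢(ℝ, ℂ)) : Integrable (fun x => f x * g x) :=
  (SchwartzMap.pairing (ContinuousLinearMap.mul ℝ ℂ) f g).integrable

theorem integral_oscillator_mul (f g : 𝓢(ℝ, ℂ)) :
    ∫ x, oscillator f x * g x = ∫ x, f x * oscillator g x := by
  have e (f : 𝓢(ℝ, ℂ)) : (derivCLM ℝ ℂ f : ℝ → ℂ) = deriv f :=
    funext fun x => derivCLM_apply ℝ f x
  have h1 := integral_mul_deriv_eq_neg_deriv_mul f (derivCLM ℝ ℂ g)
  have h2 := integral_mul_deriv_eq_neg_deriv_mul (derivCLM ℝ ℂ f) g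
  have i1 := integrable_schwartz_mul (mulX (mulX f)) g
  have i2 := integrable_schwartz_mul (derivCLM ℝ ℂ (derivCLM ℝ ℂ f)) g
  have i3 := integrable_schwartz_mul f (mulX (mulX g))
  have i4 := integrable_schwartz_mul f (derivCLM ℝ ℂ (derivCLM ℝ ℂ g))
  simp only [oscillator, sub_apply, sub_mul, mul_sub]
  rw [integral_sub i1 i2, integral_sub i3 i4]
  simp only [derivCLM_apply, e] at h1 h2 ⊢
  rw [h1, h2, neg_neg] at *
  congr 2; ext x; simp only [mulX_apply]; ring

theorem hermiteCoeff_eq_integral (f : ℝ → ℂ) (n : ℕ) :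
    hermiteCoeff f n = ∫ x, f x * hermiteSchwartz n x := by
  simp only [hermiteCoeff, hermiteSchwartz_apply]

theorem oscillator_hermiteSchwartz (n : ℕ) (x : ℝ) :
    oscillator (hermiteSchwartz n) x = (2 * n + 1) * hermiteSchwartz n x := by
  rw [oscillator_apply, deriv_deriv_hermiteSchwartz]; ring

theorem hermiteCoeff_oscillator (f : 𝓢(ℝ, ℂ)) (n : ℕ) :
    hermiteCoeff (oscillator f) n = (2 * n + 1) * hermiteCoeff f n := by
  rw [hermiteCoeff_eq_integral, hermiteCoeff_eq_integral, integral_oscillator_mul,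
    ← integral_const_mul]
  congr 1; ext x; rw [oscillator_hermiteSchwartz]; ring

/-! ### Orthonormality of the Hermite functions. -/

theorem hermiteFun_orthogonal {m n : ℕ} (hmn : m ≠ n) :
    ∫ x, hermiteFun m x * hermiteFun n x = 0 := by
  have h := hermiteCoeff_oscillator (hermiteSchwartz m) n
  have e : hermiteCoeff (oscillator (hermiteSchwartz m)) n
      = (2 * m + 1) * hermiteCoeff (hermiteSchwartz m) n := by
    rw [hermiteCoeff, hermiteCoeff, ← integral_const_mul]
    congr 1; ext x; rw [oscillator_hermiteSchwartz]; ring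
  have h0 : hermiteCoeff (hermiteSchwartz m) n = 0 := by
    rw [e] at h
    have : ((m : ℂ) - n) * hermiteCoeff (hermiteSchwartz m) n = 0 := by linear_combination h / 2
    rcases mul_eq_zero.1 this with h | h
    · exact absurd (Nat.cast_injective (sub_eq_zero.1 h)) hmn
    · exact h
  simp only [hermiteCoeff, hermiteSchwartz_apply, ← Complex.ofReal_mul] at h0
  rw [integral_complex_ofReal] at h0
  exact_mod_cast h0

theorem integrable_hermiteFun_mul (m n : ℕ) :
    Integrable (fun x => hermiteFun m x * hermiteFun n x) := by
  have h := (integrable_schwartz_mul (hermiteSchwartz m) (hermiteSchwartz n)).re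
  simpa [hermiteSchwartz_apply] using h

theorem integral_hermiteFun_zero_sq : ∫ x, hermiteFun 0 x * hermiteFun 0 x = 1 := by
  have h : ∀ x, hermiteFun 0 x * hermiteFun 0 x = (1 / √Real.pi) * Real.exp (-1 * x ^ 2) := by
    intro x
    have h1 : √Real.pi = Real.pi ^ (1 / 4 : ℝ) * Real.pi ^ (1 / 4 : ℝ) := by
      rw [Real.sqrt_eq_rpow, ← Real.rpow_add Real.pi_pos]; norm_num
    have h2 : Real.exp (-1 * x ^ 2) = Real.exp (-x ^ 2 / 2) * Real.exp (-x ^ 2 / 2) := by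
      rw [← Real.exp_add]; ring_nf
    have : Real.pi ^ (1 / 4 : ℝ) ≠ 0 := by positivity
    rw [h1, h2]
    simp only [hermiteFun, hermitePoly, Nat.cast_zero, zero_div, Real.rpow_zero,
      Nat.factorial_zero, Nat.cast_one, Real.sqrt_one]
    field_simp
  simp only [h]
  rw [integral_const_mul, integral_gaussian]
  have : √Real.pi ≠ 0 := by positivity
  rw [div_one]; field_simp

/-- Evaluating `∫ x ψ_n ψ_{n+1}` by expanding `x ψ_n` or `x ψ_{n+1}` gives the same coefficient
times the squared norm of `ψ_{n+1}` or of `ψ_n`, so these norms agree. -/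
theorem integral_hermiteFun_sq (n : ℕ) : ∫ x, hermiteFun n x * hermiteFun n x = 1 := by
  induction n with
  | zero => exact integral_hermiteFun_zero_sq
  | succ n ih =>
    have h1 : ∫ x, (x * hermiteFun n x) * hermiteFun (n + 1) x
        = √(((n : ℝ) + 1) / 2) * ∫ x, hermiteFun (n + 1) x * hermiteFun (n + 1) x := by
      simp only [mul_hermiteFun n, add_mul, mul_assoc]
      rw [integral_add ((integrable_hermiteFun_mul _ _).const_mul _)
        ((integrable_hermiteFun_mul _ _).const_mul _), integral_const_mul, integral_const_mul,
        hermiteFun_orthogonal (show n - 1 ≠ n + 1 by omega), mul_zero, add_zero]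
    have h2 : ∫ x, hermiteFun n x * (x * hermiteFun (n + 1) x)
        = √(((n : ℝ) + 1) / 2) * ∫ x, hermiteFun n x * hermiteFun n x := by
      simp only [mul_hermiteFun (n + 1), mul_add, mul_left_comm (hermiteFun n _) (√_),
        Nat.add_sub_cancel]
      rw [integral_add ((integrable_hermiteFun_mul _ _).const_mul _)
        ((integrable_hermiteFun_mul _ _).const_mul _), integral_const_mul, integral_const_mul,
        hermiteFun_orthogonal (show n ≠ n + 1 + 1 by omega), mul_zero, zero_add]
      push_cast; rfl
    have h3 : ∫ x, (x * hermiteFun n x) * hermiteFun (n + 1) x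
        = ∫ x, hermiteFun n x * (x * hermiteFun (n + 1) x) := by
      congr 1; ext x; ring
    have : √(((n : ℝ) + 1) / 2) ≠ 0 := by positivity
    rw [h1, h2, ih] at h3
    exact mul_left_cancel₀ this h3

/-- An integrable function with integrable derivative tends to `0` at `-∞`, so it is the integral of
its derivative from there. Applied to squares, this turns `L²` information into sup bounds. -/
theorem abs_le_integral_abs_deriv {g g' : ℝ → ℝ} (hd : ∀ x, HasDerivAt g (g' x) x)
    (hg : Integrable g) (hg' : Integrable g') (x : ℝ) : |g x| ≤ ∫ y, |g' y| := by
  have ht := tendsto_zero_of_hasDerivAt_of_integrableOn_Iic (a := x) (fun y _ => hd y)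
    hg'.integrableOn hg.integrableOn
  have h := integral_Iic_of_hasDerivAt_of_tendsto' (a := x) (fun y _ => hd y) hg'.integrableOn ht
  rw [sub_zero] at h
  rw [← h]
  exact (abs_integral_le_integral_abs).trans
    (setIntegral_le_integral hg'.abs (Filter.Eventually.of_forall fun y => abs_nonneg _))

/-! ### Bounds on Hermite functions and Hermite coefficients -/

/-- The sup bound by the integral of the derivative, applied to `ψ_n²`, with the cross terms split
by AM-GM, gives `ψ_n² ≤ 1 + n + (n + 1)`. Only polynomial growth matters later, so the square root
is estimated crudely. -/
theorem abs_hermiteFun_le (n : ℕ) (x : ℝ) : |hermiteFun n x| ≤ 2 * ((n : ℝ) + 1) := by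
  set a := √((n : ℝ) / 2) with ha
  set b := √(((n : ℝ) + 1) / 2) with hb
  have ha2 : a * a = (n : ℝ) / 2 := Real.mul_self_sqrt (by positivity)
  have hb2 : b * b = ((n : ℝ) + 1) / 2 := Real.mul_self_sqrt (by positivity)
  have hd : ∀ y, HasDerivAt (fun y => hermiteFun n y * hermiteFun n y)
      (2 * a * (hermiteFun n y * hermiteFun (n - 1) y)
        - 2 * b * (hermiteFun n y * hermiteFun (n + 1) y)) y := fun y =>
    ((hasDerivAt_hermiteFun n y).mul (hasDerivAt_hermiteFun n y)).congr_deriv (by ring)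
  have hi := ((integrable_hermiteFun_mul n (n - 1)).const_mul (2 * a)).sub
    ((integrable_hermiteFun_mul n (n + 1)).const_mul (2 * b))
  have hi1 := (integrable_hermiteFun_mul (n - 1) (n - 1)).const_mul (2 * (a * a))
  have hi2 := (integrable_hermiteFun_mul (n + 1) (n + 1)).const_mul (2 * (b * b))
  have hi3 : Integrable fun y => hermiteFun n y * hermiteFun n y
      + 2 * (a * a) * (hermiteFun (n - 1) y * hermiteFun (n - 1) y) :=
    (integrable_hermiteFun_mul n n).add hi1
  have h := abs_le_integral_abs_deriv hd (integrable_hermiteFun_mul n n) hi x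
  have hbd : ∫ y, |2 * a * (hermiteFun n y * hermiteFun (n - 1) y)
        - 2 * b * (hermiteFun n y * hermiteFun (n + 1) y)|
      ≤ ∫ y, (hermiteFun n y * hermiteFun n y
        + 2 * (a * a) * (hermiteFun (n - 1) y * hermiteFun (n - 1) y))
        + 2 * (b * b) * (hermiteFun (n + 1) y * hermiteFun (n + 1) y) := by
    refine integral_mono hi.abs (hi3.add hi2) fun y => ?_
    simp only
    generalize hermiteFun n y = u
    generalize hermiteFun (n - 1) y = v
    generalize hermiteFun (n + 1) y = w
    rw [abs_le]
    constructor <;>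
      nlinarith [sq_nonneg (u + (a * v - b * w)), sq_nonneg (u - (a * v - b * w)),
        sq_nonneg (a * v + b * w)]
  rw [integral_add hi3 hi2, integral_add (integrable_hermiteFun_mul n n) hi1,
    integral_const_mul, integral_const_mul, integral_hermiteFun_sq, integral_hermiteFun_sq,
    integral_hermiteFun_sq, ha2, hb2] at hbd
  have hn : (0 : ℝ) ≤ n := n.cast_nonneg
  refine abs_le_of_sq_le_sq ?_ (by positivity)
  have := (le_abs_self _).trans (h.trans hbd)
  nlinarith

theorem sqrt_half_le (y : ℝ) (hy : 1 ≤ y) : √(y / 2) ≤ y := by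
  rw [Real.sqrt_le_left (by linarith)]; nlinarith

/-- `‖ψ_n‖` in every Schwartz seminorm grows at most polynomially in `n`. -/
theorem hermiteFun_seminorm_bound (k j : ℕ) : ∃ (C : ℝ) (p : ℕ), 0 ≤ C ∧ ∀ (n : ℕ) (x : ℝ),
    |x| ^ j * |iteratedDeriv k (hermiteFun n) x| ≤ C * ((n : ℝ) + 1) ^ p := by
  -- Both multiplication by `x` and differentiation express level `n` through levels `n ± 1` with
  -- coefficients at most `n + 1`. Each use raises the exponent by one, and the index shift costs `2
  -- ^ p`.
  have step : ∀ (C : ℝ) (p : ℕ) (n : ℕ) (u v w c d : ℝ), 0 ≤ C → u = c * v + d * w →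
      |c| ≤ (n : ℝ) + 1 → |d| ≤ (n : ℝ) + 1 →
      |v| ≤ C * ((n + 1 : ℕ) + 1 : ℝ) ^ p → |w| ≤ C * ((n - 1 : ℕ) + 1 : ℝ) ^ p →
      |u| ≤ (2 * (C * 2 ^ p)) * ((n : ℝ) + 1) ^ (p + 1) := by
    intro C p n u v w c d hC hu hc hd hv hw
    have e1 : ((n + 1 : ℕ) + 1 : ℝ) ^ p ≤ 2 ^ p * ((n : ℝ) + 1) ^ p := by
      rw [← mul_pow]; gcongr; push_cast; linarith [n.cast_nonneg (α := ℝ)]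
    have e2 : ((n - 1 : ℕ) + 1 : ℝ) ^ p ≤ 2 ^ p * ((n : ℝ) + 1) ^ p := by
      rw [← mul_pow]; gcongr
      have : ((n - 1 : ℕ) : ℝ) ≤ n := by exact_mod_cast Nat.sub_le n 1
      linarith [n.cast_nonneg (α := ℝ)]
    have hv' := hv.trans (mul_le_mul_of_nonneg_left e1 hC)
    have hw' := hw.trans (mul_le_mul_of_nonneg_left e2 hC)
    calc |u| ≤ |c| * |v| + |d| * |w| := by
          rw [hu, ← abs_mul, ← abs_mul]; exact abs_add_le _ _
      _ ≤ ((n : ℝ) + 1) * (C * (2 ^ p * ((n : ℝ) + 1) ^ p))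
          + ((n : ℝ) + 1) * (C * (2 ^ p * ((n : ℝ) + 1) ^ p)) := by gcongr
      _ = _ := by ring
  have hcoef1 (n : ℕ) : |√(((n : ℝ) + 1) / 2)| ≤ (n : ℝ) + 1 := by
    rw [abs_of_nonneg (Real.sqrt_nonneg _)]
    exact sqrt_half_le _ (by linarith [n.cast_nonneg (α := ℝ)])
  have hcoef2 (n : ℕ) : |√((n : ℝ) / 2)| ≤ (n : ℝ) + 1 := by
    refine le_trans ?_ (hcoef1 n)
    rw [abs_of_nonneg (Real.sqrt_nonneg _), abs_of_nonneg (Real.sqrt_nonneg _)]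
    gcongr; linarith
  induction k with
  | zero =>
    simp only [iteratedDeriv_zero]
    induction j with
    | zero => exact ⟨2, 1, by norm_num, fun n x => by simpa using abs_hermiteFun_le n x⟩
    | succ j ih =>
      obtain ⟨C, p, hC, h⟩ := ih
      refine ⟨2 * (C * 2 ^ p), p + 1, by positivity, fun n x => ?_⟩
      have hx (m : ℕ) : |x ^ j * hermiteFun m x| ≤ C * ((m : ℝ) + 1) ^ p := by
        rw [abs_mul, abs_pow]; exact h m x
      have := step C p n (x ^ (j + 1) * hermiteFun n x) (x ^ j * hermiteFun (n + 1) x)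
        (x ^ j * hermiteFun (n - 1) x) _ _ hC
        (by rw [pow_succ, mul_assoc, mul_hermiteFun]; ring) (hcoef1 n) (hcoef2 n)
        (hx (n + 1)) (hx (n - 1))
      rwa [abs_mul, abs_pow] at this
  | succ k ih =>
    obtain ⟨C, p, hC, h⟩ := ih
    refine ⟨2 * (C * 2 ^ p), p + 1, by positivity, fun n x => ?_⟩
    have hx (m : ℕ) : |x ^ j * iteratedDeriv k (hermiteFun m) x| ≤ C * ((m : ℝ) + 1) ^ p := by
      rw [abs_mul, abs_pow]; exact h m x
    have hsm (m : ℕ) : ContDiffAt ℝ k (hermiteFun m) x :=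
      ((contDiff_hermiteFun m).of_le (mod_cast le_top)).contDiffAt
    have e : iteratedDeriv (k + 1) (hermiteFun n) x
        = √((n : ℝ) / 2) * iteratedDeriv k (hermiteFun (n - 1)) x
          - √(((n : ℝ) + 1) / 2) * iteratedDeriv k (hermiteFun (n + 1)) x := by
      rw [iteratedDeriv_succ', funext fun y => (hasDerivAt_hermiteFun n y).deriv,
        iteratedDeriv_fun_sub (contDiffAt_const.mul (hsm _)) (contDiffAt_const.mul (hsm _)),
        iteratedDeriv_const_mul_field, iteratedDeriv_const_mul_field]
    have := step C p n (x ^ j * iteratedDeriv (k + 1) (hermiteFun n) x)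
      (x ^ j * iteratedDeriv k (hermiteFun (n + 1)) x)
      (x ^ j * iteratedDeriv k (hermiteFun (n - 1)) x) (-√(((n : ℝ) + 1) / 2)) (√((n : ℝ) / 2)) hC
      (by rw [e]; ring) (by rw [abs_neg]; exact hcoef1 n) (hcoef2 n)
      (hx (n + 1)) (hx (n - 1))
    rwa [abs_mul, abs_pow] at this

theorem add_mul_pow_le {C D : ℝ} {p q : ℕ} (hC : 0 ≤ C) (hD : 0 ≤ D) (n : ℕ) :
    C * ((n : ℝ) + 1) ^ p + D * ((n : ℝ) + 1) ^ q ≤ (C + D) * ((n : ℝ) + 1) ^ (p + q) := by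
  have h1 : (1 : ℝ) ≤ (n : ℝ) + 1 := by linarith [n.cast_nonneg (α := ℝ)]
  rw [add_mul]
  gcongr <;> first | exact h1 | omega

theorem hermiteFun_weighted_bound (k q j : ℕ) : ∃ (C : ℝ) (p : ℕ), 0 ≤ C ∧ ∀ (n : ℕ) (x : ℝ),
    (1 + x ^ 2) ^ q * (|x| ^ j * |iteratedDeriv k (hermiteFun n) x|) ≤ C * ((n : ℝ) + 1) ^ p := by
  induction q generalizing j with
  | zero => simpa using hermiteFun_seminorm_bound k j
  | succ q ih =>
    obtain ⟨C, p, hC, h⟩ := ih j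
    obtain ⟨D, r, hD, h'⟩ := ih (j + 2)
    refine ⟨C + D, p + r, by positivity, fun n x => ?_⟩
    refine le_trans (le_of_eq ?_) ((add_le_add (h n x) (h' n x)).trans (add_mul_pow_le hC hD n))
    rw [pow_add |x| j 2, sq_abs]; ring

/-- Weighted bounds for the derivatives of `ψ_n` of order at most four. -/
theorem exists_hermiteFun_weighted_bound : ∃ (C : ℝ) (p : ℕ), 0 ≤ C ∧ ∀ (n : ℕ) (x : ℝ),
    ∀ k ≤ 4, (1 + x ^ 2) ^ 3 * |iteratedDeriv k (hermiteFun n) x| ≤ C * ((n : ℝ) + 1) ^ p := by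
  have key : ∀ K : ℕ, ∃ (C : ℝ) (p : ℕ), 0 ≤ C ∧ ∀ (n : ℕ) (x : ℝ),
      ∀ k < K, (1 + x ^ 2) ^ 3 * |iteratedDeriv k (hermiteFun n) x| ≤ C * ((n : ℝ) + 1) ^ p := by
    intro K
    induction K with
    | zero => exact ⟨0, 0, le_rfl, fun n x k hk => absurd hk (Nat.not_lt_zero k)⟩
    | succ K ih =>
      obtain ⟨C, p, hC, h⟩ := ih
      obtain ⟨D, r, hD, h'⟩ := hermiteFun_weighted_bound K 3 0
      refine ⟨C + D, p + r, by positivity, fun n x k hk => ?_⟩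
      refine le_trans ?_ (add_mul_pow_le hC hD n)
      rcases Nat.lt_succ_iff_lt_or_eq.1 hk with hk | rfl
      · exact (h n x k hk).trans (le_add_of_nonneg_right (by positivity))
      · refine le_trans ?_ (le_add_of_nonneg_left (by positivity))
        simpa using h' n x
  obtain ⟨C, p, hC, h⟩ := key 5
  exact ⟨C, p, hC, fun n x k hk => h n x k (by omega)⟩

theorem norm_hermiteCoeff_le (f : 𝓢(ℝ, ℂ)) (n : ℕ) :
    ‖hermiteCoeff f n‖ ≤ (2 * ∫ x, ‖f x‖) * ((n : ℝ) + 1) := by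
  rw [hermiteCoeff, show (2 * ∫ x, ‖f x‖) * ((n : ℝ) + 1)
    = ∫ x, ‖f x‖ * (2 * ((n : ℝ) + 1)) by rw [integral_mul_const]; ring]
  refine norm_integral_le_of_norm_le (f.integrable.norm.mul_const _)
    (Filter.Eventually.of_forall fun x => ?_)
  rw [norm_mul, Complex.norm_real]
  exact mul_le_mul_of_nonneg_left (abs_hermiteFun_le n x) (norm_nonneg _)

/-- Hermite coefficients of a Schwartz function decay rapidly. -/
theorem hermiteCoeff_decay (k : ℕ) (f : 𝓢(ℝ, ℂ)) :
    ∃ C : ℝ, 0 ≤ C ∧ ∀ n : ℕ, ‖hermiteCoeff f n‖ * ((n : ℝ) + 1) ^ k ≤ C * ((n : ℝ) + 1) := by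
  induction k generalizing f with
  | zero =>
    exact ⟨2 * ∫ x, ‖f x‖, by positivity, fun n => by simpa using norm_hermiteCoeff_le f n⟩
  | succ k ih =>
    -- Each application of the oscillator multiplies the `n`-th coefficient by `2n+1 ≥ n+1`.
    obtain ⟨C, hC, h⟩ := ih (oscillator f)
    refine ⟨C, hC, fun n => le_trans ?_ (h n)⟩
    have e : ‖hermiteCoeff (oscillator f) n‖ = (2 * n + 1) * ‖hermiteCoeff f n‖ := by
      rw [hermiteCoeff_oscillator, norm_mul]
      congr 1
      exact_mod_cast Complex.norm_natCast (2 * n + 1)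
    rw [e, pow_succ]
    have hn : (0 : ℝ) ≤ n := n.cast_nonneg
    have : 0 ≤ ‖hermiteCoeff f n‖ * ((n : ℝ) + 1) ^ k := by positivity
    nlinarith

theorem summable_hermiteCoeff (f : 𝓢(ℝ, ℂ)) (k : ℕ) :
    Summable fun n : ℕ => ‖hermiteCoeff f n‖ * ((n : ℝ) + 1) ^ k := by
  -- One of the three extra powers cancels the growth allowed in the decay bound; the other two
  -- leave `1/(n+1)²`.
  obtain ⟨C, hC, h⟩ := hermiteCoeff_decay (k + 3) f
  have hs : Summable fun n : ℕ => C * (1 / ((n : ℝ) + 1) ^ 2) := by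
    have := (summable_nat_add_iff 1).2 (Real.summable_one_div_nat_pow (p := 2).2 (by norm_num))
    push_cast at this
    exact this.mul_left C
  refine Summable.of_nonneg_of_le (fun n => by positivity) (fun n => ?_) hs
  have hn : (0 : ℝ) < (n : ℝ) + 1 := by positivity
  rw [mul_one_div, le_div_iff₀ (by positivity)]
  have := h n
  rw [pow_add, show (3 : ℕ) = 2 + 1 from rfl, pow_succ _ 2, ← mul_assoc, ← mul_assoc] at this
  exact le_of_mul_le_mul_right this hn

/-! ### Smooth functions in the sense of weighted Sobolev spaces are Schwartz functions -/

/-- The derivative of `x^{2j} |f|²` is integrable: Cauchy-Schwarz puts the whole weight on `f`, as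
`x^{4j} |f|²`, and so needs only the unweighted norm of `f'`. -/
theorem exists_bound_weighted_norm_sq {f f' : ℝ → ℂ} (hd : ∀ x, HasDerivAt f (f' x) x) (j : ℕ)
    (h0 : ∀ i : ℕ, Integrable fun x : ℝ => |x| ^ (2 * i) * ‖f x‖ ^ 2)
    (h1 : Integrable fun x => ‖f' x‖ ^ 2) (hc : Continuous f') :
    ∃ C : ℝ, ∀ x, |x| ^ (2 * j) * ‖f x‖ ^ 2 ≤ C := by
  have hcf : Continuous f := continuous_iff_continuousAt.2 fun x => (hd x).continuousAt
  have hdg : ∀ x : ℝ, HasDerivAt (fun y : ℝ => y ^ (2 * j) * ‖f y‖ ^ 2)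
      (((2 * j : ℕ) : ℝ) * x ^ (2 * j - 1) * ‖f x‖ ^ 2 + x ^ (2 * j) * (2 * inner ℝ (f x) (f' x)))
      x := fun x => (hasDerivAt_pow (2 * j) x).mul (hd x).norm_sq
  have hi : Integrable fun x : ℝ => ((2 * j : ℕ) : ℝ) * x ^ (2 * j - 1) * ‖f x‖ ^ 2
      + x ^ (2 * j) * (2 * inner ℝ (f x) (f' x)) := by
    have hb := (((h0 0).add (h0 j)).const_mul ((2 * j : ℕ) : ℝ)).add ((h0 (2 * j)).add h1)
    refine hb.mono' (by fun_prop) (Filter.Eventually.of_forall fun x => ?_)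
    simp only [Pi.add_apply, mul_zero, pow_zero, one_mul]
    refine (norm_add_le _ _).trans (add_le_add ?_ ?_)
    · rw [norm_mul, norm_mul, norm_pow, Real.norm_natCast, Real.norm_eq_abs, norm_pow, norm_norm,
        mul_assoc]
      refine mul_le_mul_of_nonneg_left ?_ (by positivity)
      rw [← one_add_mul]
      refine mul_le_mul_of_nonneg_right ?_ (by positivity)
      rcases le_total |x| 1 with hx | hx
      · exact (pow_le_one₀ (abs_nonneg x) hx).trans (le_add_of_nonneg_right (by positivity))
      · exact (pow_le_pow_right₀ hx (by omega)).trans (le_add_of_nonneg_left (by positivity))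
    · rw [norm_mul, norm_mul, norm_pow, Real.norm_eq_abs, Real.norm_two,
        show 2 * (2 * j) = 2 * j + 2 * j by ring, pow_add]
      have h := norm_inner_le_norm (𝕜 := ℝ) (f x) (f' x)
      have h2 : |x| ^ (2 * j) * (2 * ‖inner ℝ (f x) (f' x)‖)
          ≤ |x| ^ (2 * j) * (2 * (‖f x‖ * ‖f' x‖)) := by gcongr
      refine h2.trans ?_
      nlinarith [sq_nonneg (|x| ^ (2 * j) * ‖f x‖ - ‖f' x‖)]
  have habs (x : ℝ) : |x| ^ (2 * j) = x ^ (2 * j) := by rw [pow_mul, pow_mul, sq_abs]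
  have hg : Integrable fun x : ℝ => x ^ (2 * j) * ‖f x‖ ^ 2 := by
    simpa only [habs] using h0 j
  have h := abs_le_integral_abs_deriv hdg hg hi
  simp only [habs]
  exact ⟨_, fun x => (le_abs_self _).trans (h x)⟩

/-- Rapid decay in the supremum norm. -/
def RapidDecay (g : ℝ → ℂ) : Prop := ∀ j : ℕ, ∃ C : ℝ, ∀ x : ℝ, (1 + |x|) ^ j * ‖g x‖ ≤ C

/-- If `g` decays rapidly and `g''` is bounded then `g'` decays rapidly. -/
theorem RapidDecay.deriv_of_bound {g g' g'' : ℝ → ℂ} (hg : RapidDecay g)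
    (hd : ∀ x, HasDerivAt g (g' x) x) (hd' : ∀ x, HasDerivAt g' (g'' x) x)
    {B : ℝ} (hB : ∀ x, ‖g'' x‖ ≤ B) : RapidDecay g' := by
  intro j
  obtain ⟨C, hC⟩ := hg (2 * j)
  refine ⟨2 ^ (2 * j) * C + C + B, fun x => ?_⟩
  have hB0 : 0 ≤ B := (norm_nonneg _).trans (hB 0)
  set W := (1 + |x|) ^ j with hW
  have hW1 : 1 ≤ W := one_le_pow₀ (by linarith [abs_nonneg x])
  have hW0 : 0 < W := by linarith
  -- Landau-type interpolation: `η g'(x) = g(x+η) - g(x) + O(B η²)`. With `η = (1+|x|)^{-j}`, decay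
  -- of `g` of order `2j` balances the remainder and yields decay of `g'` of order `j`.
  set η := W⁻¹ with hη
  have hη0 : 0 < η := by positivity
  have hη1 : η ≤ 1 := inv_le_one_of_one_le₀ hW1
  have hmv : ‖(g (x + η) - ((x + η - x : ℝ) : ℂ) * g' x) - (g x - ((x - x : ℝ) : ℂ) * g' x)‖
      ≤ (B * η) * ‖x + η - x‖ := by
    refine Convex.norm_image_sub_le_of_norm_hasDerivWithin_le
      (f := fun y => g y - ((y - x : ℝ) : ℂ) * g' x) (f' := fun y => g' y - g' x)
      (s := Set.Icc x (x + η)) ?_ ?_ (convex_Icc _ _) ⟨le_rfl, by linarith⟩ ⟨by linarith, le_rfl⟩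
    · intro y _
      have h1 : HasDerivAt (fun y : ℝ => ((y - x : ℝ) : ℂ)) ((1 : ℝ) : ℂ) y :=
        ((hasDerivAt_id y).sub_const x).ofReal_comp
      exact (((hd y).sub (h1.mul_const (g' x))).congr_deriv (by simp)).hasDerivWithinAt
    · intro y hy
      have := Convex.norm_image_sub_le_of_norm_hasDerivWithin_le (f := g') (f' := g'')
        (s := Set.univ) (fun z _ => (hd' z).hasDerivWithinAt) (fun z _ => hB z) convex_univ
        (Set.mem_univ x) (Set.mem_univ y)
      refine this.trans (mul_le_mul_of_nonneg_left ?_ hB0)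
      rw [Real.norm_eq_abs, abs_of_nonneg (by linarith [hy.1])]; linarith [hy.2]
  have h3 : η * ‖g' x‖ ≤ ‖g (x + η)‖ + ‖g x‖ + B * η * η := by
    have e : (η : ℂ) * g' x = (g (x + η) - g x) - ((g (x + η) - ((x + η - x : ℝ) : ℂ) * g' x)
        - (g x - ((x - x : ℝ) : ℂ) * g' x)) := by push_cast; ring
    have e2 : η * ‖g' x‖ = ‖(η : ℂ) * g' x‖ := by
      rw [norm_mul, Complex.norm_real, Real.norm_eq_abs, abs_of_pos hη0]
    rw [e2, e]
    refine (norm_sub_le _ _).trans (add_le_add (norm_sub_le _ _) ?_)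
    refine hmv.trans (le_of_eq ?_)
    rw [add_sub_cancel_left, Real.norm_eq_abs, abs_of_pos hη0]
  have hW2 : (1 + |x|) ^ (2 * j) = W * W := by rw [hW, two_mul, pow_add]
  have h4 : W * W * ‖g (x + η)‖ ≤ 2 ^ (2 * j) * C := by
    refine le_trans ?_ (mul_le_mul_of_nonneg_left (hC (x + η)) (by positivity))
    rw [← hW2, ← mul_assoc, ← mul_pow]
    gcongr
    have := abs_sub_abs_le_abs_sub x (x + η)
    rw [show x - (x + η) = -η by ring, abs_neg, abs_of_pos hη0] at this
    linarith [abs_nonneg (x + η)]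
  have h5 : W * W * ‖g x‖ ≤ C := by rw [← hW2]; exact hC x
  have hWη : W * η = 1 := mul_inv_cancel₀ hW0.ne'
  calc W * ‖g' x‖ = W * W * (η * ‖g' x‖) := by
        rw [show W * W * (η * ‖g' x‖) = (W * η) * (W * ‖g' x‖) by ring, hWη, one_mul]
    _ ≤ W * W * (‖g (x + η)‖ + ‖g x‖ + B * η * η) := by gcongr
    _ = W * W * ‖g (x + η)‖ + W * W * ‖g x‖ + B * (W * η) * (W * η) := by ring
    _ ≤ _ := by rw [hWη]; linarith

theorem IsSmooth.hasDerivAt_iteratedDeriv {f : ℝ → ℂ} (hf : IsSmooth f) (k : ℕ) (x : ℝ) :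
    HasDerivAt (iteratedDeriv k f) (iteratedDeriv (k + 1) f x) x := by
  rw [iteratedDeriv_succ]
  exact ((hf.contDiff.differentiable_iteratedDeriv k (mod_cast ENat.natCast_lt_top k)) x).hasDerivAt

theorem IsSmooth.integrable_sq {f : ℝ → ℂ} (hf : IsSmooth f) (k : ℕ) :
    Integrable fun x => ‖iteratedDeriv k f x‖ ^ 2 :=
  (memLp_two_iff_integrable_sq_norm (hf.memLp_deriv k).1).1 (hf.memLp_deriv k)

theorem IsSmooth.integrable_weight {f : ℝ → ℂ} (hf : IsSmooth f) (i : ℕ) :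
    Integrable fun x : ℝ => |x| ^ (2 * i) * ‖f x‖ ^ 2 := by
  have h := (memLp_two_iff_integrable_sq_norm (hf.memLp_weight i).1).1 (hf.memLp_weight i)
  have hc : Continuous f := hf.contDiff.continuous
  refine h.mono' (by fun_prop) (Filter.Eventually.of_forall fun x => ?_)
  rw [Real.norm_of_nonneg (by positivity), norm_mul, mul_pow, Complex.norm_real,
    Real.norm_of_nonneg (by positivity), ← pow_mul, mul_comm i 2, pow_mul (√_),
    Real.sq_sqrt (by positivity), pow_mul, sq_abs]
  gcongr
  linarith

theorem IsSmooth.continuous_iteratedDeriv {f : ℝ → ℂ} (hf : IsSmooth f) (k : ℕ) :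
    Continuous (iteratedDeriv k f) :=
  hf.contDiff.continuous_iteratedDeriv k (mod_cast le_top)

theorem IsSmooth.exists_bound {f : ℝ → ℂ} (hf : IsSmooth f) (k : ℕ) :
    ∃ B : ℝ, ∀ x, ‖iteratedDeriv k f x‖ ≤ B := by
  have h := fun x => (hf.hasDerivAt_iteratedDeriv k x).norm_sq
  have hc := hf.continuous_iteratedDeriv k
  have hc' := hf.continuous_iteratedDeriv (k + 1)
  have hi : Integrable fun x => 2 * inner ℝ (iteratedDeriv k f x) (iteratedDeriv (k + 1) f x) := by
    refine ((hf.integrable_sq k).add (hf.integrable_sq (k + 1))).mono' (by fun_prop)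
      (Filter.Eventually.of_forall fun x => ?_)
    have h := norm_inner_le_norm (𝕜 := ℝ) (iteratedDeriv k f x) (iteratedDeriv (k + 1) f x)
    rw [norm_mul, Real.norm_two]
    simp only [Pi.add_apply]
    nlinarith [sq_nonneg (‖iteratedDeriv k f x‖ - ‖iteratedDeriv (k + 1) f x‖)]
  have h' := abs_le_integral_abs_deriv h (hf.integrable_sq k) hi
  exact ⟨_, fun x => Real.le_sqrt_of_sq_le ((le_abs_self _).trans (h' x))⟩

/-- Weights are assumed only on `f` itself. Decay passes to the derivatives one at a time, by
interpolation against the boundedness of the derivative two orders higher. -/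
theorem IsSmooth.rapidDecay {f : ℝ → ℂ} (hf : IsSmooth f) (k : ℕ) :
    RapidDecay (iteratedDeriv k f) := by
  induction k with
  | zero =>
    intro j
    have hd : ∀ x, HasDerivAt f (iteratedDeriv 1 f x) x := by
      simpa using hf.hasDerivAt_iteratedDeriv 0
    have hb (j : ℕ) := exists_bound_weighted_norm_sq hd j hf.integrable_weight
      (hf.integrable_sq 1) (hf.continuous_iteratedDeriv 1)
    obtain ⟨C, hC⟩ := hb 0
    obtain ⟨D, hD⟩ := hb j
    refine ⟨√(2 ^ (2 * j) * (C + D)), fun x => Real.le_sqrt_of_sq_le ?_⟩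
    rw [iteratedDeriv_zero, mul_pow, ← pow_mul, mul_comm j 2]
    have hC0 := hC x
    have hD0 := hD x
    rw [mul_zero, pow_zero, one_mul] at hC0
    have h0 : (1 + |x|) ^ (2 * j) ≤ 2 ^ (2 * j) * (1 + |x| ^ (2 * j)) := by
      rcases le_total |x| 1 with hx | hx
      · calc (1 + |x|) ^ (2 * j) ≤ 2 ^ (2 * j) := by gcongr; linarith
          _ ≤ _ := le_mul_of_one_le_right (by positivity) (le_add_of_nonneg_right (by positivity))
      · calc (1 + |x|) ^ (2 * j) ≤ (2 * |x|) ^ (2 * j) := by gcongr; linarith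
          _ = 2 ^ (2 * j) * |x| ^ (2 * j) := mul_pow _ _ _
          _ ≤ _ := by gcongr; linarith
    calc (1 + |x|) ^ (2 * j) * ‖f x‖ ^ 2
        ≤ 2 ^ (2 * j) * (1 + |x| ^ (2 * j)) * ‖f x‖ ^ 2 := by gcongr
      _ = 2 ^ (2 * j) * (‖f x‖ ^ 2 + |x| ^ (2 * j) * ‖f x‖ ^ 2) := by ring
      _ ≤ _ := by gcongr
  | succ k ih =>
    obtain ⟨B, hB⟩ := hf.exists_bound (k + 2)
    exact ih.deriv_of_bound (hf.hasDerivAt_iteratedDeriv k) (hf.hasDerivAt_iteratedDeriv (k + 1)) hB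

theorem IsSmooth.exists_schwartz {f : ℝ → ℂ} (hf : IsSmooth f) : ∃ F : 𝓢(ℝ, ℂ), (F : ℝ → ℂ) = f := by
  refine ⟨⟨f, hf.contDiff, fun k n => ?_⟩, rfl⟩
  obtain ⟨C, hC⟩ := hf.rapidDecay n k
  refine ⟨C, fun x => le_trans ?_ (hC x)⟩
  rw [norm_iteratedFDeriv_eq_norm_iteratedDeriv, Real.norm_eq_abs]
  gcongr
  linarith

/-! ### Completeness of the Hermite functions -/

theorem norm_evolutionTerm_le (f : ℝ → ℂ) (t x : ℝ) (n : ℕ) :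
    ‖evolutionTerm f t x n‖ ≤ 2 * (‖hermiteCoeff f n‖ * ((n : ℝ) + 1) ^ 1) := by
  have h : ‖Complex.exp (-Complex.I * (2 * n + 1) * t)‖ = 1 := by
    rw [show -Complex.I * (2 * n + 1) * t = ((-(2 * n + 1) * t : ℝ) : ℂ) * Complex.I by
      push_cast; ring]
    exact Complex.norm_exp_ofReal_mul_I _
  rw [evolutionTerm, norm_mul, norm_mul, h, Complex.norm_real, mul_one, pow_one]
  calc _ ≤ ‖hermiteCoeff f n‖ * (2 * ((n : ℝ) + 1)) :=
        mul_le_mul_of_nonneg_left (abs_hermiteFun_le n x) (norm_nonneg _)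
    _ = _ := by ring

theorem summable_evolutionTerm (f : 𝓢(ℝ, ℂ)) (t x : ℝ) : Summable (evolutionTerm f t x) :=
  Summable.of_norm_bounded ((summable_hermiteCoeff f 1).mul_left 2) (norm_evolutionTerm_le f t x)

theorem mulX_hermiteSchwartz (m : ℕ) :
    mulX (hermiteSchwartz m) = √(((m : ℝ) + 1) / 2) • hermiteSchwartz (m + 1)
      + √((m : ℝ) / 2) • hermiteSchwartz (m - 1) := by
  ext x
  simp only [mulX_apply, add_apply, smul_apply, hermiteSchwartz_apply, Complex.real_smul]
  exact_mod_cast mul_hermiteFun m x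

theorem mulX_pow_apply (n : ℕ) (f : 𝓢(ℝ, ℂ)) (x : ℝ) : (mulX ^ n) f x = (x : ℂ) ^ n * f x := by
  induction n generalizing f with
  | zero => simp
  | succ n ih => rw [pow_succ, mul_apply_eq_comp, ih, mulX_apply, pow_succ, mul_assoc]

/-- A bounded continuous function orthogonal to all Hermite functions vanishes. -/
theorem eq_zero_of_hermiteCoeff_eq_zero {g : ℝ → ℂ} (hc : Continuous g) {B : ℝ}
    (hB : ∀ x, ‖g x‖ ≤ B) (h0 : ∀ n, hermiteCoeff g n = 0) : g = 0 := by
  have hint (S : 𝓢(ℝ, ℂ)) : Integrable fun x => g x * S x :=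
    S.integrable.bdd_mul hc.aestronglyMeasurable (Filter.Eventually.of_forall hB)
  -- The three-term recurrence trades a factor `x` for a shift of the Hermite index, so all moments
  -- of `g ψ_m` vanish.
  have hmom (n m : ℕ) : ∫ x, g x * (mulX ^ n) (hermiteSchwartz m) x = 0 := by
    induction n generalizing m with
    | zero => simpa [hermiteCoeff_eq_integral] using h0 m
    | succ n ih =>
      have e : ∀ x, g x * (mulX ^ (n + 1)) (hermiteSchwartz m) x
          = (√(((m : ℝ) + 1) / 2) : ℂ) * (g x * (mulX ^ n) (hermiteSchwartz (m + 1)) x)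
            + (√((m : ℝ) / 2) : ℂ) * (g x * (mulX ^ n) (hermiteSchwartz (m - 1)) x) := by
        intro x
        rw [pow_succ, mul_apply_eq_comp, mulX_hermiteSchwartz, map_add, map_smul,
          map_smul, add_apply, smul_apply, smul_apply, Complex.real_smul, Complex.real_smul]
        ring
      simp only [e]
      rw [integral_add ((hint _).const_mul _) ((hint _).const_mul _), integral_const_mul,
        integral_const_mul, ih, ih, mul_zero, mul_zero, add_zero]
  set G : ℝ → ℂ := fun x => g x * hermiteSchwartz 0 x with hG
  have hGi : Integrable G := hint _
  have hGc : Continuous G := hc.mul (hermiteSchwartz 0).continuous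
  -- Expand the Fourier kernel in its power series and integrate termwise: every term is a vanishing
  -- moment. Domination comes from `‖c‖|v| ≤ ‖c‖² + v²/4`, which leaves half of the Gaussian
  -- exponent. Fourier inversion and `ψ_0 > 0` then give `g = 0`.
  have hF : FourierTransform.fourier G = 0 := by
    ext w
    rw [Real.fourier_real_eq_integral_exp_smul]
    set c : ℂ := -2 * Real.pi * w * Complex.I with hcdef
    set F : ℕ → ℝ → ℂ := fun n v => c ^ n / (n.factorial : ℂ) * (g v * (mulX ^ n) (hermiteSchwartz 0) v)
      with hFdef
    have hFn (n : ℕ) : ∫ v, F n v = 0 := by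
      simp only [hFdef]
      rw [integral_const_mul, hmom, mul_zero]
    have hFe (n : ℕ) (v : ℝ) : F n v = (c * v) ^ n / (n.factorial : ℂ) * G v := by
      simp only [hFdef, hG, mulX_pow_apply, mul_pow]; ring
    have hFb (n : ℕ) (v : ℝ) : ‖F n v‖ = (‖c‖ * |v|) ^ n / (n.factorial : ℝ) * ‖G v‖ := by
      rw [hFe, norm_mul, norm_div, norm_pow, norm_mul, Complex.norm_real, Complex.norm_natCast,
        Real.norm_eq_abs]
    have hexp (v : ℝ) : HasSum (fun n : ℕ => (‖c‖ * |v|) ^ n / (n.factorial : ℝ) * ‖G v‖)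
        (Real.exp (‖c‖ * |v|) * ‖G v‖) := by
      have := NormedSpace.expSeries_div_hasSum_exp (𝔸 := ℝ) (‖c‖ * |v|)
      rw [← Real.exp_eq_exp_ℝ] at this
      exact this.mul_right _
    have hbi : Integrable fun v => Real.exp (‖c‖ * |v|) * ‖G v‖ := by
      have hgi : Integrable fun v : ℝ => (B * (1 / (Real.pi ^ (1 / 4 : ℝ))) * Real.exp (‖c‖ ^ 2))
          * Real.exp (-(1 / 4) * v ^ 2) :=
        (integrable_exp_neg_mul_sq (by norm_num)).const_mul _
      refine hgi.mono' (by fun_prop) (Filter.Eventually.of_forall fun v => ?_)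
      rw [Real.norm_of_nonneg (by positivity), hG]
      simp only
      rw [norm_mul (g v), hermiteSchwartz_apply, Complex.norm_real, hermiteFun]
      simp only [Nat.cast_zero, zero_div, Real.rpow_zero, mul_one, Nat.factorial_zero, Nat.cast_one,
        Real.sqrt_one, hermitePoly]
      rw [Real.norm_of_nonneg (by positivity)]
      have h1 : Real.exp (‖c‖ * |v|) * Real.exp (-v ^ 2 / 2)
          ≤ Real.exp (‖c‖ ^ 2) * Real.exp (-(1 / 4) * v ^ 2) := by
        rw [← Real.exp_add, ← Real.exp_add, Real.exp_le_exp]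
        nlinarith [sq_nonneg (‖c‖ - |v| / 2), sq_abs v]
      calc _ = ‖g v‖ * (1 / Real.pi ^ (1 / 4 : ℝ))
              * (Real.exp (‖c‖ * |v|) * Real.exp (-v ^ 2 / 2)) := by ring
        _ ≤ B * (1 / Real.pi ^ (1 / 4 : ℝ))
              * (Real.exp (‖c‖ ^ 2) * Real.exp (-(1 / 4) * v ^ 2)) := by
            have := hB v
            have := (norm_nonneg _).trans this
            gcongr
        _ = _ := by ring
    have key := hasSum_integral_of_dominated_convergence (μ := volume) (F := F)
      (f := fun v => Complex.exp (((-2 * Real.pi * v * w : ℝ) : ℂ) * Complex.I) • G v)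
      (fun n v => (‖c‖ * |v|) ^ n / (n.factorial : ℝ) * ‖G v‖)
      (fun n => ((hint _).const_mul _).aestronglyMeasurable)
      (fun n => Filter.Eventually.of_forall fun v => (hFb n v).le)
      (Filter.Eventually.of_forall fun v => (hexp v).summable)
      (by simpa only [fun v => (hexp v).tsum_eq] using hbi)
      (Filter.Eventually.of_forall fun v => by
        have := NormedSpace.expSeries_div_hasSum_exp (𝔸 := ℂ) (c * v)
        rw [← Complex.exp_eq_exp_ℂ] at this
        simp only [hFe, smul_eq_mul]
        rw [show ((-2 * Real.pi * v * w : ℝ) : ℂ) * Complex.I = c * v by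
          rw [hcdef]; push_cast; ring]
        exact this.mul_right (G v))
    simp only [hFn] at key
    exact (hasSum_zero.unique key).symm
  have hinv := hGc.fourierInv_fourier_eq hGi (by rw [hF]; exact integrable_zero _ _ _)
  have hG0 : G = 0 := by
    rw [← hinv, hF]
    ext w
    simp [Real.fourierInv_eq]
  ext x
  have := congrFun hG0 x
  simp only [hG, Pi.zero_apply, hermiteSchwartz_apply] at this
  rcases mul_eq_zero.1 this with h | h
  · exact h
  · exfalso
    have h' : hermiteFun 0 x = 0 := by exact_mod_cast h
    have : 0 < hermiteFun 0 x := by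
      simp only [hermiteFun, hermitePoly]; positivity
    exact this.ne' h'

/-- The Hermite expansion of a Schwartz function converges to it pointwise. -/
theorem hasSum_hermite_expansion (f : 𝓢(ℝ, ℂ)) (x : ℝ) :
    HasSum (fun n => hermiteCoeff f n * (hermiteFun n x : ℂ)) (f x) := by
  have hbound (n : ℕ) (x : ℝ) : ‖hermiteCoeff f n * (hermiteFun n x : ℂ)‖
      ≤ 2 * (‖hermiteCoeff f n‖ * ((n : ℝ) + 1) ^ 1) := by
    simpa [evolutionTerm] using norm_evolutionTerm_le f 0 x n
  have hs := (summable_hermiteCoeff f 1).mul_left 2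
  have hsum (x : ℝ) : Summable fun n => hermiteCoeff f n * (hermiteFun n x : ℂ) :=
    Summable.of_norm_bounded hs (hbound · x)
  set S : ℝ → ℂ := fun x => ∑' n, hermiteCoeff f n * (hermiteFun n x : ℂ) with hS
  have hSc : Continuous S := continuous_tsum
    (fun n => continuous_const.mul (Complex.continuous_ofReal.comp
      (contDiff_hermiteFun n).continuous)) hs hbound
  have hSb (x : ℝ) : ‖S x‖ ≤ ∑' n, 2 * (‖hermiteCoeff f n‖ * ((n : ℝ) + 1) ^ 1) :=
    tsum_of_norm_bounded hs.hasSum (hbound · x)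
  obtain ⟨D, -, hD⟩ := f.decay 0 0
  have hfb (x : ℝ) : ‖f x‖ ≤ D := by simpa using hD x
  -- Termwise integration and orthonormality; then `f - S` is continuous, bounded and orthogonal to
  -- every `ψ_n`.
  have hScoeff (n : ℕ) : hermiteCoeff S n = hermiteCoeff f n := by
    rw [hermiteCoeff_eq_integral S]
    have hi (m : ℕ) : Integrable fun x =>
        hermiteCoeff f m * (hermiteSchwartz m x * hermiteSchwartz n x) :=
      (integrable_schwartz_mul _ _).const_mul _
    have hval (m : ℕ) : ∫ x, hermiteCoeff f m * (hermiteSchwartz m x * hermiteSchwartz n x)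
        = if m = n then hermiteCoeff f n else 0 := by
      rw [integral_const_mul]
      simp only [hermiteSchwartz_apply, ← Complex.ofReal_mul]
      rw [integral_complex_ofReal]
      split_ifs with h
      · rw [h, integral_hermiteFun_sq]; simp
      · rw [hermiteFun_orthogonal h]; simp
    have key := hasSum_integral_of_summable_integral_norm hi (by
      refine Summable.of_nonneg_of_le (fun m => by positivity) (fun m => ?_)
        (hs.mul_right (∫ x, ‖hermiteSchwartz n x‖))
      rw [← integral_const_mul]
      refine integral_mono (hi m).norm ((hermiteSchwartz n).integrable.norm.const_mul _) fun x => ?_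
      simp only
      rw [← mul_assoc, norm_mul, hermiteSchwartz_apply m]
      exact mul_le_mul_of_nonneg_right (hbound m x) (norm_nonneg _))
    simp only [hval] at key
    have h2 := (hasSum_ite_eq n (hermiteCoeff f n)).unique key
    rw [h2]
    congr 1; ext x
    rw [hS, ← tsum_mul_right]
    congr 1; ext m; rw [hermiteSchwartz_apply m]; ring
  have hz : (fun x => f x - S x) = 0 := by
    refine eq_zero_of_hermiteCoeff_eq_zero (f.continuous.sub hSc)
      (B := D + ∑' n, 2 * (‖hermiteCoeff f n‖ * ((n : ℝ) + 1) ^ 1))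
      (fun x => (norm_sub_le _ _).trans (add_le_add (hfb x) (hSb x))) fun n => ?_
    have hi1 := integrable_schwartz_mul f (hermiteSchwartz n)
    have hi2 : Integrable fun x => S x * hermiteSchwartz n x :=
      (hermiteSchwartz n).integrable.bdd_mul hSc.aestronglyMeasurable
        (Filter.Eventually.of_forall hSb)
    rw [hermiteCoeff_eq_integral]
    simp only [sub_mul]
    rw [integral_sub hi1 hi2, ← hermiteCoeff_eq_integral, ← hermiteCoeff_eq_integral, hScoeff,
      sub_self]
  have : f x = S x := sub_eq_zero.1 (congrFun hz x)
  rw [this]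
  exact (hsum x).hasSum

/-! ### Kravchuk polynomials -/

/-- The sum is the eigenvalue difference equation, the difference a raising relation. At `a ± h` the
factor `2x` of the recurrence becomes `2a ± 2h`, which mixes the two, so the induction closes only
for the pair. -/
theorem kravchukPoly_difference (h a : ℝ) (n : ℕ) :
    (1 - a * h) * kravchukPoly h n (a + h) + (1 + a * h) * kravchukPoly h n (a - h)
        = (2 - 2 * n * h ^ 2) * kravchukPoly h n a ∧
      (1 - a * h) * kravchukPoly h n (a + h) - (1 + a * h) * kravchukPoly h n (a - h)
        = 2 * h * (a * kravchukPoly h n a - kravchukPoly h (n + 1) a) := by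
  induction n using Nat.twoStepInduction with
  | zero => simp only [kravchukPoly]; constructor <;> push_cast <;> ring
  | one => simp only [kravchukPoly]; constructor <;> push_cast <;> ring
  | more n ih₀ ih₁ =>
    obtain ⟨L0, M0⟩ := ih₀
    obtain ⟨L1, M1⟩ := ih₁
    have r2 : kravchukPoly h (n + 2) a = 2 * a * kravchukPoly h (n + 1) a
      - 2 * ((n : ℝ) + 1) * (1 - h ^ 2 * ((n : ℝ) / 2)) * kravchukPoly h n a := rfl
    have r3 : kravchukPoly h (n + 2 + 1) a = 2 * a * kravchukPoly h (n + 2) a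
      - 2 * (((n + 1 : ℕ) : ℝ) + 1) * (1 - h ^ 2 * (((n + 1 : ℕ) : ℝ) / 2))
        * kravchukPoly h (n + 1) a := rfl
    have p2 : kravchukPoly h (n + 2) (a + h) = 2 * (a + h) * kravchukPoly h (n + 1) (a + h)
      - 2 * ((n : ℝ) + 1) * (1 - h ^ 2 * ((n : ℝ) / 2)) * kravchukPoly h n (a + h) := rfl
    have m2 : kravchukPoly h (n + 2) (a - h) = 2 * (a - h) * kravchukPoly h (n + 1) (a - h)
      - 2 * ((n : ℝ) + 1) * (1 - h ^ 2 * ((n : ℝ) / 2)) * kravchukPoly h n (a - h) := rfl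
    rw [show n + 1 + 1 = n + 2 from rfl] at M1
    rw [r3, p2, m2]
    set c := 2 * ((n : ℝ) + 1) * (1 - h ^ 2 * ((n : ℝ) / 2)) with hc
    push_cast at *
    constructor
    · linear_combination 2 * a * L1 + 2 * h * M1 - c * L0 - (2 - 2 * n * h ^ 2) * r2
    · linear_combination 2 * a * M1 + 2 * h * L1 - c * M0 - 2 * a * h * r2

/-! ### The grid -/

/-- The grid point `k h`. -/
noncomputable def pt (h : ℝ) (k : ℤ) : Grid h := ⟨k * h, k, by simp⟩

@[simp] theorem coe_pt (h : ℝ) (k : ℤ) : ((pt h k : Grid h) : ℝ) = k * h := rfl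

theorem pt_surjective (h : ℝ) : Function.Surjective (pt h) := by
  rintro ⟨_, k, rfl⟩
  exact ⟨k, Subtype.ext (by simp)⟩

theorem pt_injective {h : ℝ} (h0 : 0 < h) : Function.Injective (pt h) := by
  intro k l hkl
  have : (k : ℝ) * h = l * h := congrArg Subtype.val hkl
  exact_mod_cast mul_right_cancel₀ h0.ne' this

theorem pt_add_step (h : ℝ) (k : ℤ) : pt h k + Grid.step h = pt h (k + 1) :=
  Subtype.ext (by simp [Grid.step, add_mul])

theorem pt_sub_step (h : ℝ) (k : ℤ) : pt h k - Grid.step h = pt h (k - 1) :=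
  Subtype.ext (by simp [Grid.step, sub_mul])

/-- The mesh `h = M^{-1/2}` corresponding to `N = 2M`. -/
structure IsMesh (M : ℕ) (h : ℝ) : Prop where
  pos : 0 < h
  sq_mul : h ^ 2 * M = 1

namespace IsMesh

variable {M : ℕ} {h : ℝ}

theorem inv_sq (hm : IsMesh M h) : 1 / h ^ 2 = M := by
  have := hm.pos
  rw [div_eq_iff (by positivity), mul_comm, hm.sq_mul]

theorem two_div_sq (hm : IsMesh M h) : 2 / h ^ 2 = (2 * M : ℕ) := by
  have := hm.inv_sq
  push_cast
  rw [← this]; ring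

theorem inA_pt_iff (hm : IsMesh M h) (k : ℤ) : InA h (pt h k) ↔ -(M : ℤ) ≤ k ∧ k ≤ M := by
  have h0 := hm.pos
  have e : 1 / h = M * h := by
    rw [div_eq_iff h0.ne']
    linear_combination -hm.sq_mul
  rw [InA, coe_pt, e, Set.mem_Icc, ← neg_mul, mul_le_mul_iff_left₀ h0, mul_le_mul_iff_left₀ h0]
  norm_cast

/-! ### The binomial weight and the eigenvalue equation of the Kravchuk functions. -/

theorem rho_of_mem (hm : IsMesh M h) (j : ℕ) (hj : j ≤ 2 * M) :
    rho h (pt h ((j : ℤ) - M)) = 1 / h * (((2 * M).choose j : ℝ) / 2 ^ (2 * M)) := by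
  have h0 := hm.pos
  have hA : InA h (pt h ((j : ℤ) - M)) := (hm.inA_pt_iff _).2 (by omega)
  have e1 : 1 + 1 / h ^ 2 + ((pt h ((j : ℤ) - M) : Grid h) : ℝ) / h = (j : ℝ) + 1 := by
    rw [hm.inv_sq, coe_pt, mul_div_cancel_right₀ _ h0.ne']; push_cast; ring
  have e2 : 1 + 1 / h ^ 2 - ((pt h ((j : ℤ) - M) : Grid h) : ℝ) / h = ((2 * M - j : ℕ) : ℝ) + 1 := by
    rw [hm.inv_sq, coe_pt, mul_div_cancel_right₀ _ h0.ne', Nat.cast_sub hj]; push_cast; ring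
  rw [rho, if_pos hA, e1, e2, hm.two_div_sq, Real.rpow_natCast, add_comm (1 : ℝ),
    Real.Gamma_nat_eq_factorial, Real.Gamma_nat_eq_factorial, Real.Gamma_nat_eq_factorial,
    Nat.cast_choose ℝ hj]
  have : (2 : ℝ) ^ (2 * M) ≠ 0 := by positivity
  field_simp

theorem rho_of_notMem {a : Grid h} (ha : ¬ InA h a) : rho h a = 0 := if_neg ha

theorem rho_nonneg (hm : IsMesh M h) (k : ℤ) : 0 ≤ rho h (pt h k) := by
  by_cases hk : InA h (pt h k)
  · have hk' := (hm.inA_pt_iff k).1 hk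
    obtain ⟨j, hj⟩ := Int.eq_ofNat_of_zero_le (show 0 ≤ k + M by omega)
    have : k = (j : ℤ) - M := by omega
    rw [this, hm.rho_of_mem j (by omega)]
    have := hm.pos
    positivity
  · rw [rho_of_notMem hk]

/-- Detailed balance for the binomial weight. -/
theorem rho_balance (hm : IsMesh M h) (k : ℤ) :
    (1 + (k + 1) * h ^ 2) * rho h (pt h (k + 1)) = (1 - k * h ^ 2) * rho h (pt h k) := by
  have hsq := hm.sq_mul
  -- At the two edges `k = -M-1` and `k = M` one weight is zero and the coefficient of the other is
  -- `1 - M h² = 0`. In the interior this is the ratio of consecutive binomial coefficients.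
  rcases lt_trichotomy k (-(M : ℤ) - 1) with hk | hk | hk
  · rw [rho_of_notMem (mt (hm.inA_pt_iff _).1 (by omega)),
      rho_of_notMem (mt (hm.inA_pt_iff _).1 (by omega)), mul_zero, mul_zero]
  · rw [rho_of_notMem (a := pt h k) (mt (hm.inA_pt_iff _).1 (by omega)), mul_zero, hk]
    push_cast
    have : 1 + (-(M : ℝ) - 1 + 1) * h ^ 2 = 0 := by linear_combination -hsq
    rw [this, zero_mul]
  rcases lt_trichotomy k M with hk' | hk' | hk'
  · obtain ⟨j, hj⟩ := Int.eq_ofNat_of_zero_le (show 0 ≤ k + M by omega)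
    have e : k = (j : ℤ) - M := by omega
    have e' : k + 1 = ((j + 1 : ℕ) : ℤ) - M := by push_cast; omega
    rw [e', e, hm.rho_of_mem j (by omega), hm.rho_of_mem (j + 1) (by omega)]
    have hc := Nat.choose_succ_right_eq (2 * M) j
    have hc' : (((2 * M).choose (j + 1) : ℕ) : ℝ) * ((j : ℝ) + 1)
        = ((2 * M).choose j : ℝ) * (2 * M - j) := by
      have : ((2 * M - j : ℕ) : ℝ) = 2 * M - j := by rw [Nat.cast_sub (by omega)]; push_cast; ring
      rw [← this]; exact_mod_cast hc
    push_cast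
    linear_combination (h ^ 2 * (1 / h * (1 / 2 ^ (2 * M)))) * hc'
      + (1 / h * (1 / 2 ^ (2 * M))) * (((2 * M).choose j : ℝ) - (2 * M).choose (j + 1)) * hsq
  · rw [rho_of_notMem (a := pt h (k + 1)) (mt (hm.inA_pt_iff _).1 (by omega)), mul_zero, hk']
    push_cast
    have : 1 - (M : ℝ) * h ^ 2 = 0 := by linear_combination -hsq
    rw [this, zero_mul]
  · rw [rho_of_notMem (mt (hm.inA_pt_iff _).1 (by omega)),
      rho_of_notMem (mt (hm.inA_pt_iff _).1 (by omega)), mul_zero, mul_zero]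

/-- The unnormalized Kravchuk functions are eigenfunctions of the Kravchuk oscillator. -/
theorem oscillator_kravchukPoly (hm : IsMesh M h) (n : ℕ) (a : Grid h) :
    kravchukOscillator h (fun b => ((kravchukPoly h n b * √(rho h b) : ℝ) : ℂ)) a
      = (2 * n + 1) * ((kravchukPoly h n a * √(rho h a) : ℝ) : ℂ) := by
  have h0 := hm.pos
  obtain ⟨k, rfl⟩ := pt_surjective h a
  by_cases hA : InA h (pt h k)
  · have hk := (hm.inA_pt_iff k).1 hA
    have hk1 : 0 ≤ 1 - k * h ^ 2 := by
      have : (k : ℝ) ≤ M := by exact_mod_cast hk.2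
      nlinarith [hm.sq_mul, sq_nonneg h]
    have hk2 : 0 ≤ 1 + k * h ^ 2 := by
      have : -(M : ℝ) ≤ k := by exact_mod_cast hk.1
      nlinarith [hm.sq_mul, sq_nonneg h]
    -- Detailed balance converts the neighbouring `√ρ` into `√ρ` at the point itself, with factor `1
    -- - ah` here and `1 + ah` in `s2`. The weight then factors out and the polynomial difference
    -- equation remains.
    have s1 : √((1 + k * h * h + h ^ 2) * (1 - k * h * h)) * √(rho h (pt h (k + 1)))
        = (1 - k * h ^ 2) * √(rho h (pt h k)) := by
      rw [← Real.sqrt_mul (mul_nonneg (by nlinarith) (by nlinarith)),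
        ← Real.sqrt_sq hk1, ← Real.sqrt_mul (sq_nonneg _)]
      congr 1
      linear_combination (1 - k * h ^ 2) * hm.rho_balance k
    have s2 : √((1 - k * h * h + h ^ 2) * (1 + k * h * h)) * √(rho h (pt h (k - 1)))
        = (1 + k * h ^ 2) * √(rho h (pt h k)) := by
      rw [← Real.sqrt_mul (mul_nonneg (by nlinarith) (by nlinarith)),
        ← Real.sqrt_sq hk2, ← Real.sqrt_mul (sq_nonneg _)]
      congr 1
      have := hm.rho_balance (k - 1)
      rw [sub_add_cancel] at this
      push_cast at this
      linear_combination -(1 + k * h ^ 2) * this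
    rw [kravchukOscillator, if_pos hA, pt_add_step, pt_sub_step]
    simp only [coe_pt]
    norm_cast
    have d := (kravchukPoly_difference h (k * h) n).1
    push_cast
    rw [show ((k : ℝ) + 1) * h = k * h + h by ring, show ((k : ℝ) - 1) * h = k * h - h by ring]
    have hne : h ^ 2 ≠ 0 := by positivity
    have hi : 1 / h ^ 2 * h ^ 2 = 1 := by field_simp
    rw [show 2 / h ^ 2 = 2 * (1 / h ^ 2) by ring]
    linear_combination (-(1 / h ^ 2) * kravchukPoly h n (k * h + h)) * s1
      - (1 / h ^ 2) * kravchukPoly h n (k * h - h) * s2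
      - (1 / h ^ 2) * √(rho h (pt h k)) * d
      + 2 * n * kravchukPoly h n (k * h) * √(rho h (pt h k)) * hi
  · rw [kravchukOscillator, if_neg hA, rho_of_notMem hA]; simp

theorem oscillator_const_mul (c : ℂ) (u : Grid h → ℂ) (a : Grid h) :
    kravchukOscillator h (fun b => c * u b) a = c * kravchukOscillator h u a := by
  unfold kravchukOscillator
  split_ifs <;> ring

theorem oscillator_sum {ι : Type*} (s : Finset ι) (u : ι → Grid h → ℂ) (a : Grid h) :
    kravchukOscillator h (fun b => ∑ i ∈ s, u i b) a = ∑ i ∈ s, kravchukOscillator h (u i) a := by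
  unfold kravchukOscillator
  split_ifs
  · simp only [Finset.sum_add_distrib, Finset.sum_sub_distrib, Finset.mul_sum]
  · simp

theorem oscillator_kravchukFun (hm : IsMesh M h) (n : ℕ) (a : Grid h) :
    kravchukOscillator h (fun b => (kravchukFun n h b : ℂ)) a
      = (2 * n + 1) * (kravchukFun n h a : ℂ) := by
  have e : (fun b : Grid h => (kravchukFun n h b : ℂ))
      = fun b : Grid h => (alpha n h : ℂ) * ((kravchukPoly h n b * √(rho h b) : ℝ) : ℂ) := by
    ext b; simp only [kravchukFun]; push_cast; ring
  rw [e, oscillator_const_mul, hm.oscillator_kravchukPoly]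
  simp only [kravchukFun]; push_cast; ring

theorem solves (hm : IsMesh M h) (f : ℝ → ℂ) (nmax : ℕ) :
    SolvesDiscreteSchrodinger h (discreteEvolution f nmax h) := by
  intro t a
  have hd : HasDerivAt (fun τ : ℝ => discreteEvolution f nmax h τ a)
      (∑ n ∈ Finset.range (nmax + 1), kravchukCoeff f n h
        * (Complex.exp (-Complex.I * (2 * n + 1) * t) * (-Complex.I * (2 * n + 1)))
        * (kravchukFun n h a : ℂ)) t := by
    refine HasDerivAt.fun_sum fun n _ => ?_
    have h1 : HasDerivAt (fun τ : ℝ => -Complex.I * (2 * n + 1) * (τ : ℂ))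
        (-Complex.I * (2 * n + 1)) t := by
      simpa using (Complex.ofRealCLM.hasDerivAt (x := t)).const_mul (-Complex.I * (2 * n + 1))
    exact (h1.cexp.const_mul _).mul_const _
  refine hd.congr_deriv ?_
  have e : discreteEvolution f nmax h t = fun b => ∑ n ∈ Finset.range (nmax + 1),
      (kravchukCoeff f n h * Complex.exp (-Complex.I * (2 * n + 1) * t))
        * (kravchukFun n h b : ℂ) := rfl
  rw [e, oscillator_sum, Finset.mul_sum]
  refine Finset.sum_congr rfl fun n _ => ?_
  rw [oscillator_const_mul, hm.oscillator_kravchukFun]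
  ring

/-- The Kravchuk oscillator is symmetric for the bilinear pairing on `A_h`. -/
theorem oscillator_symm (hm : IsMesh M h) (u v : Grid h → ℂ) :
    ∑ j ∈ Finset.range (2 * M + 1),
        kravchukOscillator h u (pt h ((j : ℤ) - M)) * v (pt h ((j : ℤ) - M))
      = ∑ j ∈ Finset.range (2 * M + 1),
        u (pt h ((j : ℤ) - M)) * kravchukOscillator h v (pt h ((j : ℤ) - M)) := by
  have hsq := hm.sq_mul
  set s : ℤ → ℂ := fun k =>
    ((1 / h ^ 2 * √((1 + k * h * h + h ^ 2) * (1 - k * h * h)) : ℝ) : ℂ) with hs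
  -- The coefficient from `k` to `k - 1` equals the one from `k - 1` to `k`: the Jacobi matrix is
  -- symmetric. It also vanishes across both ends of `A_h` (`htop`, `hbot`), so summation by parts
  -- has no boundary terms.
  have hs' (k : ℤ) : ((1 / h ^ 2 * √((1 - k * h * h + h ^ 2) * (1 + k * h * h)) : ℝ) : ℂ)
      = s (k - 1) := by
    simp only [hs]; congr 3; push_cast; ring
  have hval (w : Grid h → ℂ) (j : ℕ) (hj : j ∈ Finset.range (2 * M + 1)) :
      kravchukOscillator h w (pt h ((j : ℤ) - M))
        = -s ((j : ℤ) - M) * w (pt h ((j : ℤ) - M + 1)) - s ((j : ℤ) - M - 1)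
          * w (pt h ((j : ℤ) - M - 1)) + ((1 + 2 / h ^ 2 : ℝ) : ℂ) * w (pt h ((j : ℤ) - M)) := by
    have hj' := Finset.mem_range.1 hj
    rw [kravchukOscillator, if_pos ((hm.inA_pt_iff _).2 (by omega)), pt_add_step, pt_sub_step,
      ← hs']
    rfl
  have htop : s (((2 * M : ℕ) : ℤ) - M) = 0 := by
    have : 1 - ((((2 * M : ℕ) : ℤ) - M : ℤ) : ℝ) * h * h = 0 := by
      push_cast; linear_combination -hsq
    simp only [hs, this]; simp
  have hbot : s (((0 : ℕ) : ℤ) - M - 1) = 0 := by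
    have : 1 + ((((0 : ℕ) : ℤ) - M - 1 : ℤ) : ℝ) * h * h + h ^ 2 = 0 := by
      push_cast; linear_combination -hsq
    simp only [hs, this]; simp
  have shift (u v : Grid h → ℂ) :
      ∑ j ∈ Finset.range (2 * M + 1), s ((j : ℤ) - M) * u (pt h ((j : ℤ) - M + 1))
        * v (pt h ((j : ℤ) - M))
      = ∑ j ∈ Finset.range (2 * M + 1), s ((j : ℤ) - M - 1) * u (pt h ((j : ℤ) - M))
        * v (pt h ((j : ℤ) - M - 1)) := by
    rw [Finset.sum_range_succ, htop, Finset.sum_range_succ', hbot]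
    simp only [zero_mul, add_zero]
    refine Finset.sum_congr rfl fun j _ => ?_
    rw [show ((j + 1 : ℕ) : ℤ) - M - 1 = (j : ℤ) - M by push_cast; ring,
      show ((j + 1 : ℕ) : ℤ) - M = (j : ℤ) - M + 1 by push_cast; ring]
  have e1 : ∀ j ∈ Finset.range (2 * M + 1),
      kravchukOscillator h u (pt h ((j : ℤ) - M)) * v (pt h ((j : ℤ) - M))
        - u (pt h ((j : ℤ) - M)) * kravchukOscillator h v (pt h ((j : ℤ) - M))
      = (s ((j : ℤ) - M) * v (pt h ((j : ℤ) - M + 1)) * u (pt h ((j : ℤ) - M))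
          - s ((j : ℤ) - M - 1) * v (pt h ((j : ℤ) - M)) * u (pt h ((j : ℤ) - M - 1)))
        - (s ((j : ℤ) - M) * u (pt h ((j : ℤ) - M + 1)) * v (pt h ((j : ℤ) - M))
          - s ((j : ℤ) - M - 1) * u (pt h ((j : ℤ) - M)) * v (pt h ((j : ℤ) - M - 1))) := by
    intro j hj
    rw [hval u j hj, hval v j hj]; ring
  rw [← sub_eq_zero, ← Finset.sum_sub_distrib, Finset.sum_congr rfl e1, Finset.sum_sub_distrib,
    Finset.sum_sub_distrib, Finset.sum_sub_distrib, shift, shift]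
  ring

/-! ### Orthonormality of the Kravchuk functions -/

/-- Eigenvectors of a symmetric operator for the distinct eigenvalues `2m+1` and `2n+1`. -/
theorem kravchukPoly_orthogonal (hm : IsMesh M h) {m n : ℕ} (hmn : m ≠ n) :
    ∑ j ∈ Finset.range (2 * M + 1), rho h (pt h ((j : ℤ) - M))
      * (kravchukPoly h m (pt h ((j : ℤ) - M)) * kravchukPoly h n (pt h ((j : ℤ) - M))) = 0 := by
  have hs := hm.oscillator_symm (fun b => ((kravchukPoly h m b * √(rho h b) : ℝ) : ℂ))
    (fun b => ((kravchukPoly h n b * √(rho h b) : ℝ) : ℂ))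
  simp only [hm.oscillator_kravchukPoly] at hs
  have e (c : ℂ) (j : ℕ) :
      c * (((kravchukPoly h m (pt h ((j : ℤ) - M)) * √(rho h (pt h ((j : ℤ) - M))) : ℝ) : ℂ)
        * ((kravchukPoly h n (pt h ((j : ℤ) - M)) * √(rho h (pt h ((j : ℤ) - M))) : ℝ) : ℂ))
      = c * ((rho h (pt h ((j : ℤ) - M)) * (kravchukPoly h m (pt h ((j : ℤ) - M))
        * kravchukPoly h n (pt h ((j : ℤ) - M))) : ℝ) : ℂ) := by
    rw [← Complex.ofReal_mul]
    congr 2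
    linear_combination kravchukPoly h m (pt h ((j : ℤ) - M)) * kravchukPoly h n (pt h ((j : ℤ) - M))
      * Real.mul_self_sqrt (hm.rho_nonneg ((j : ℤ) - M))
  simp only [mul_assoc (2 * (m : ℂ) + 1), mul_left_comm _ (2 * (n : ℂ) + 1), e,
    ← Finset.mul_sum, ← Complex.ofReal_sum] at hs
  have h2 : ((m : ℂ) - n) * ((∑ j ∈ Finset.range (2 * M + 1), rho h (pt h ((j : ℤ) - M))
      * (kravchukPoly h m (pt h ((j : ℤ) - M)) * kravchukPoly h n (pt h ((j : ℤ) - M))) : ℝ) : ℂ)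
      = 0 := by
    linear_combination hs / 2
  rcases mul_eq_zero.1 h2 with h | h
  · exact absurd (Nat.cast_injective (sub_eq_zero.1 h)) hmn
  · exact_mod_cast h

theorem sum_rho (hm : IsMesh M h) :
    h * ∑ j ∈ Finset.range (2 * M + 1), rho h (pt h ((j : ℤ) - M)) = 1 := by
  have h0 := hm.pos
  rw [Finset.sum_congr rfl fun j hj =>
    hm.rho_of_mem j (Nat.lt_succ_iff.1 (Finset.mem_range.1 hj)), ← Finset.mul_sum,
    ← Finset.sum_div, ← Nat.cast_sum, Nat.sum_range_choose]
  push_cast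
  have : (2 : ℝ) ^ (2 * M) ≠ 0 := by positivity
  field_simp

/-- Pairing `2x k_n` with `k_{n+1}` through the recurrence at either index shows that the norm ratio
is the recurrence coefficient `2(n+1)(1 - h² n/2)`, rewritten with `h² M = 1`. -/
theorem kravchukPoly_norm_succ (hm : IsMesh M h) (n : ℕ) :
    ∑ j ∈ Finset.range (2 * M + 1), rho h (pt h ((j : ℤ) - M))
      * (kravchukPoly h (n + 1) (pt h ((j : ℤ) - M)) * kravchukPoly h (n + 1) (pt h ((j : ℤ) - M)))
    = (h ^ 2 * (n + 1) * (2 * M - n)) * ∑ j ∈ Finset.range (2 * M + 1), rho h (pt h ((j : ℤ) - M))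
      * (kravchukPoly h n (pt h ((j : ℤ) - M)) * kravchukPoly h n (pt h ((j : ℤ) - M))) := by
  set S : ℕ → ℕ → ℝ := fun m n => ∑ j ∈ Finset.range (2 * M + 1), rho h (pt h ((j : ℤ) - M))
      * (kravchukPoly h m (pt h ((j : ℤ) - M)) * kravchukPoly h n (pt h ((j : ℤ) - M))) with hS
  have hS0 {m n : ℕ} (hmn : m ≠ n) : S m n = 0 := hm.kravchukPoly_orthogonal hmn
  set X : ℝ := ∑ j ∈ Finset.range (2 * M + 1), rho h (pt h ((j : ℤ) - M))
      * (2 * (pt h ((j : ℤ) - M) : ℝ) * kravchukPoly h n (pt h ((j : ℤ) - M))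
        * kravchukPoly h (n + 1) (pt h ((j : ℤ) - M))) with hX
  have h1 : X = S (n + 1) (n + 1) := by
    rcases n with _ | n
    · simp only [hX, hS, kravchukPoly, mul_one]
    · have : X = S (n + 2) (n + 2)
          + 2 * ((n : ℝ) + 1) * (1 - h ^ 2 * ((n : ℝ) / 2)) * S n (n + 2) := by
        simp only [hX, hS, kravchukPoly]
        rw [Finset.mul_sum, ← Finset.sum_add_distrib]
        exact Finset.sum_congr rfl fun j _ => by ring
      rw [this, hS0 (show n ≠ n + 2 by omega), mul_zero, add_zero]
  have h2 : X = S n (n + 2) + 2 * ((n : ℝ) + 1) * (1 - h ^ 2 * ((n : ℝ) / 2)) * S n n := by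
    simp only [hX, hS, kravchukPoly]
    rw [Finset.mul_sum, ← Finset.sum_add_distrib]
    exact Finset.sum_congr rfl fun j _ => by ring
  rw [hS0 (by omega), zero_add] at h2
  change S (n + 1) (n + 1) = _ * S n n
  rw [← h1, h2]
  linear_combination (-2 * ((n : ℝ) + 1) * S n n) * hm.sq_mul

theorem kravchukPoly_norm (hm : IsMesh M h) (n : ℕ) (hn : n ≤ 2 * M) :
    (h * ∑ j ∈ Finset.range (2 * M + 1), rho h (pt h ((j : ℤ) - M))
      * (kravchukPoly h n (pt h ((j : ℤ) - M)) * kravchukPoly h n (pt h ((j : ℤ) - M))))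
      * ((2 * M - n).factorial : ℝ) = (h ^ n) ^ 2 * n.factorial * (2 * M).factorial := by
  induction n with
  | zero =>
    simp only [kravchukPoly, mul_one]
    rw [hm.sum_rho]; simp
  | succ n ih =>
    have ih := ih (by omega)
    rw [hm.kravchukPoly_norm_succ]
    have hf : (2 * M - n).factorial = (2 * M - n) * (2 * M - (n + 1)).factorial := by
      rw [show 2 * M - n = (2 * M - (n + 1)) + 1 by omega, Nat.factorial_succ]
    have hf' : ((2 * M - n).factorial : ℝ) = (2 * M - n) * ((2 * M - (n + 1)).factorial : ℝ) := by
      rw [hf, Nat.cast_mul, Nat.cast_sub (by omega)]; push_cast; ring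
    rw [hf'] at ih
    rw [Nat.factorial_succ]
    push_cast
    linear_combination (h ^ 2 * (n + 1)) * ih

theorem alpha_sq (hm : IsMesh M h) (n : ℕ) (hn : n ≤ 2 * M) :
    alpha n h * alpha n h * ((h ^ n) ^ 2 * n.factorial * (2 * M).factorial)
      = ((2 * M - n).factorial : ℝ) := by
  have h0 := hm.pos
  have e : 1 + 2 / h ^ 2 - (n : ℝ) = ((2 * M - n : ℕ) : ℝ) + 1 := by
    rw [hm.two_div_sq, Nat.cast_sub hn]; push_cast; ring
  rw [alpha, e, hm.two_div_sq, add_comm (1 : ℝ), Real.Gamma_nat_eq_factorial,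
    Real.Gamma_nat_eq_factorial]
  have h1 : √(n.factorial : ℝ) * √(n.factorial : ℝ) = n.factorial :=
    Real.mul_self_sqrt (by positivity)
  have h2 := Real.mul_self_sqrt (show (0 : ℝ) ≤ ((2 * M - n).factorial : ℝ) / ((2 * M).factorial : ℝ)
    by positivity)
  set x := √(((2 * M - n).factorial : ℝ) / ((2 * M).factorial : ℝ))
  have hx : x * x * ((2 * M).factorial : ℝ) = ((2 * M - n).factorial : ℝ) := by
    rw [h2]; field_simp
  have hs : √(n.factorial : ℝ) ≠ 0 := by positivity
  generalize √(n.factorial : ℝ) = y at h1 hs ⊢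
  rw [← hx, ← h1]
  field_simp

theorem kravchukFun_orthonormal (hm : IsMesh M h) {m n : ℕ} (hn : n ≤ 2 * M) :
    h * ∑ j ∈ Finset.range (2 * M + 1), kravchukFun m h (pt h ((j : ℤ) - M))
      * kravchukFun n h (pt h ((j : ℤ) - M)) = if m = n then 1 else 0 := by
  have e : ∑ j ∈ Finset.range (2 * M + 1), kravchukFun m h (pt h ((j : ℤ) - M))
      * kravchukFun n h (pt h ((j : ℤ) - M)) = alpha m h * alpha n h
      * ∑ j ∈ Finset.range (2 * M + 1), rho h (pt h ((j : ℤ) - M))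
      * (kravchukPoly h m (pt h ((j : ℤ) - M)) * kravchukPoly h n (pt h ((j : ℤ) - M))) := by
    rw [Finset.mul_sum]
    refine Finset.sum_congr rfl fun j _ => ?_
    simp only [kravchukFun]
    linear_combination alpha m h * alpha n h * kravchukPoly h m (pt h ((j : ℤ) - M))
      * kravchukPoly h n (pt h ((j : ℤ) - M)) * Real.mul_self_sqrt (hm.rho_nonneg ((j : ℤ) - M))
  rw [e]
  split_ifs with hmn
  · subst hmn
    have h1 := hm.kravchukPoly_norm m hn
    have h2 := hm.alpha_sq m hn
    have hf : ((2 * M - m).factorial : ℝ) ≠ 0 := by positivity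
    refine mul_right_cancel₀ hf ?_
    rw [← h1] at h2
    rw [one_mul]
    linear_combination h2
  · rw [hm.kravchukPoly_orthogonal hmn, mul_zero, mul_zero]

/-- The vector of values of `√h u` on `A_h`. -/
noncomputable def toVec (M : ℕ) (h : ℝ) (u : Grid h → ℂ) : EuclideanSpace ℂ (Fin (2 * M + 1)) :=
  WithLp.toLp 2 fun j => (√h : ℂ) * u (pt h ((j : ℕ) - (M : ℤ)))

theorem inner_toVec (hm : IsMesh M h) (u : Grid h → ℝ) (v : Grid h → ℂ) :
    inner ℂ (toVec M h fun a => (u a : ℂ)) (toVec M h v)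
      = h * ∑ j ∈ Finset.range (2 * M + 1), v (pt h ((j : ℤ) - M)) * (u (pt h ((j : ℤ) - M)) : ℂ) := by
  have hs : (√h : ℂ) * √h = h := by
    rw [← Complex.ofReal_mul, Real.mul_self_sqrt hm.pos.le]
  rw [PiLp.inner_apply, Finset.sum_range, Finset.mul_sum]
  refine Finset.sum_congr rfl fun j _ => ?_
  simp only [toVec, RCLike.inner_apply, map_mul, Complex.conj_ofReal]
  linear_combination v (pt h ((j : ℕ) - (M : ℤ))) * (u (pt h ((j : ℕ) - (M : ℤ))) : ℂ) * hs

theorem norm_sq_toVec (hm : IsMesh M h) (v : Grid h → ℂ) :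
    ‖toVec M h v‖ ^ 2 = h * ∑ j ∈ Finset.range (2 * M + 1), ‖v (pt h ((j : ℤ) - M))‖ ^ 2 := by
  rw [EuclideanSpace.norm_sq_eq, Finset.sum_range, Finset.mul_sum]
  refine Finset.sum_congr rfl fun j _ => ?_
  simp only [toVec, norm_mul, mul_pow, Complex.norm_real, Real.norm_eq_abs, sq_abs,
    Real.sq_sqrt hm.pos.le]

theorem orthonormal_toVec (hm : IsMesh M h) : Orthonormal ℂ fun n : Fin (2 * M + 1) =>
    toVec M h fun a => (kravchukFun n h a : ℂ) := by
  rw [orthonormal_iff_ite]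
  intro m n
  rw [hm.inner_toVec]
  have := hm.kravchukFun_orthonormal (m := n) (n := m) (by omega)
  simp only [← Complex.ofReal_mul, ← Complex.ofReal_sum]
  rw [this]
  simp only [Fin.ext_iff, eq_comm (a := (n : ℕ))]
  split_ifs <;> simp

/-- The Kravchuk functions form an orthonormal basis of `ℓ²(A_h)`. -/
noncomputable def kravchukBasis (hm : IsMesh M h) :
    OrthonormalBasis (Fin (2 * M + 1)) ℂ (EuclideanSpace ℂ (Fin (2 * M + 1))) :=
  (basisOfOrthonormalOfCardEqFinrank hm.orthonormal_toVec (by simp)).toOrthonormalBasis (by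
    simpa using hm.orthonormal_toVec)

theorem kravchukBasis_apply (hm : IsMesh M h) (n : Fin (2 * M + 1)) :
    hm.kravchukBasis n = toVec M h fun a => (kravchukFun n h a : ℂ) := by
  simp [kravchukBasis]

end IsMesh

/-! ### Truncated spectral expansions -/

/-- Here `r` plays the role of the residual of `w` as an approximate eigenvector. Off the diagonal
the spectral gap `|2n-2m| ≥ 2` beats any phase difference; on the diagonal the phases cancel when `m
≤ nmax`. No growth in time can occur, since only `‖e n‖ = 1` is used. -/
theorem norm_truncated_evolution_le {E : Type*} [NormedAddCommGroup E] [InnerProductSpace ℂ E]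
    {K : ℕ} (b : OrthonormalBasis (Fin K) ℂ E) (e : ℕ → ℂ) (he : ∀ n, ‖e n‖ = 1) (m nmax : ℕ)
    (w r : E) (hr : ∀ n : Fin K, inner ℂ (b n) r = (2 * (n : ℂ) - 2 * m) * inner ℂ (b n) w) :
    (m ≤ nmax → ‖e m • w - ∑ n : Fin K, (if (n : ℕ) ≤ nmax then e n * inner ℂ (b n) w else 0) • b n‖
      ≤ ‖r‖) ∧
    ‖e m • w - ∑ n : Fin K, (if (n : ℕ) ≤ nmax then e n * inner ℂ (b n) w else 0) • b n‖
      ≤ 2 * ‖w‖ := by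
  set D := e m • w - ∑ n : Fin K, (if (n : ℕ) ≤ nmax then e n * inner ℂ (b n) w else 0) • b n with hD
  have hc (n : Fin K) : inner ℂ (b n) D
      = (e m - if (n : ℕ) ≤ nmax then e n else 0) * inner ℂ (b n) w := by
    rw [hD, inner_sub_right, inner_smul_right, b.orthonormal.inner_right_fintype]
    split_ifs <;> ring
  have h2 (n : Fin K) : ‖e m - if (n : ℕ) ≤ nmax then e n else 0‖ ≤ 2 := by
    refine (norm_sub_le _ _).trans ?_
    rw [he]
    split_ifs
    · rw [he]; norm_num
    · rw [norm_zero]; norm_num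
  constructor
  · intro hmn
    refine le_of_sq_le_sq ?_ (norm_nonneg _)
    rw [← b.sum_sq_norm_inner_right D, ← b.sum_sq_norm_inner_right r]
    refine Finset.sum_le_sum fun n _ => ?_
    rw [hc, hr]
    refine pow_le_pow_left₀ (norm_nonneg _) ?_ 2
    rw [norm_mul, norm_mul]
    refine mul_le_mul_of_nonneg_right ?_ (norm_nonneg _)
    by_cases hnm : (n : ℕ) = m
    · rw [hnm, if_pos hmn, sub_self, norm_zero]; positivity
    · refine (h2 n).trans ?_
      have : (2 * (n : ℂ) - 2 * m) = ((2 * ((n : ℤ) - m) : ℤ) : ℂ) := by push_cast; ring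
      rw [this, Complex.norm_intCast]
      have h1 : 1 ≤ |((n : ℕ) : ℤ) - m| := Int.one_le_abs (by omega)
      rw [← Int.cast_abs, abs_mul]
      have : (2 : ℤ) ≤ |2| * |((n : ℕ) : ℤ) - m| := by rw [abs_two]; omega
      exact_mod_cast this
  · refine le_of_sq_le_sq ?_ (by positivity)
    rw [mul_pow, ← b.sum_sq_norm_inner_right D, ← b.sum_sq_norm_inner_right w, Finset.mul_sum]
    refine Finset.sum_le_sum fun n _ => ?_
    rw [hc, norm_mul, mul_pow]
    gcongr
    exact h2 n

namespace IsMesh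

variable {M : ℕ} {h : ℝ}

/-- The coefficient `⟨u, φ_{n,h}⟩` over `A_h`. -/
noncomputable def gridCoeff (M : ℕ) (h : ℝ) (u : Grid h → ℂ) (n : ℕ) : ℂ :=
  h * ∑ j ∈ Finset.range (2 * M + 1),
    u (pt h ((j : ℤ) - M)) * (kravchukFun n h (pt h ((j : ℤ) - M)) : ℂ)

/-- Error of the truncated Kravchuk evolution of an approximate eigenfunction `u`. -/
theorem truncation_error_le (hm : IsMesh M h) (u : Grid h → ℂ) (e : ℕ → ℂ) (he : ∀ n, ‖e n‖ = 1)
    (m nmax : ℕ) (hn : nmax ≤ 2 * M) :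
    (m ≤ nmax → h * ∑ j ∈ Finset.range (2 * M + 1), ‖e m * u (pt h ((j : ℤ) - M))
        - ∑ n ∈ Finset.range (nmax + 1), gridCoeff M h u n * e n
          * (kravchukFun n h (pt h ((j : ℤ) - M)) : ℂ)‖ ^ 2
      ≤ h * ∑ j ∈ Finset.range (2 * M + 1), ‖kravchukOscillator h u (pt h ((j : ℤ) - M))
        - (2 * m + 1) * u (pt h ((j : ℤ) - M))‖ ^ 2) ∧
    h * ∑ j ∈ Finset.range (2 * M + 1), ‖e m * u (pt h ((j : ℤ) - M))
        - ∑ n ∈ Finset.range (nmax + 1), gridCoeff M h u n * e n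
          * (kravchukFun n h (pt h ((j : ℤ) - M)) : ℂ)‖ ^ 2
      ≤ 4 * (h * ∑ j ∈ Finset.range (2 * M + 1), ‖u (pt h ((j : ℤ) - M))‖ ^ 2) := by
  set D : Grid h → ℂ := fun a => e m * u a
        - ∑ n ∈ Finset.range (nmax + 1), gridCoeff M h u n * e n * (kravchukFun n h a : ℂ) with hD
  set r : Grid h → ℂ := fun a => kravchukOscillator h u a - (2 * m + 1) * u a with hr
  have hb (v : Grid h → ℂ) (n : Fin (2 * M + 1)) :
      inner ℂ (hm.kravchukBasis n) (toVec M h v) = gridCoeff M h v n := by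
    rw [kravchukBasis_apply, hm.inner_toVec]; rfl
  -- Symmetry moves `H_h` onto `φ_n`, which yields `(2n+1) - (2m+1)`.
  have hcoef (n : Fin (2 * M + 1)) : inner ℂ (hm.kravchukBasis n) (toVec M h r)
      = (2 * (n : ℂ) - 2 * m) * inner ℂ (hm.kravchukBasis n) (toVec M h u) := by
    rw [hb, hb, gridCoeff, gridCoeff]
    have hs := hm.oscillator_symm u fun b => (kravchukFun n h b : ℂ)
    simp only [hm.oscillator_kravchukFun] at hs
    simp only [hr, sub_mul]
    rw [Finset.sum_sub_distrib, hs]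
    simp only [mul_left_comm (u _) (2 * ((n : ℕ) : ℂ) + 1), mul_assoc (2 * (m : ℂ) + 1),
      ← Finset.mul_sum]
    ring
  have hvec : toVec M h D = e m • toVec M h u - ∑ n : Fin (2 * M + 1), (if (n : ℕ) ≤ nmax then
      e n * inner ℂ (hm.kravchukBasis n) (toVec M h u) else 0) • hm.kravchukBasis n := by
    ext j
    simp only [hb]
    simp only [kravchukBasis_apply]
    rw [PiLp.sub_apply, PiLp.smul_apply, WithLp.ofLp_sum, Finset.sum_apply]
    simp only [toVec, hD, PiLp.smul_apply, smul_eq_mul]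
    rw [mul_sub, Finset.mul_sum]
    congr 1
    · ring
    · set F : ℕ → ℂ := fun n => if n ∈ Finset.range (nmax + 1) then (√h : ℂ) * (gridCoeff M h u n
        * e n * (kravchukFun n h (pt h ((j : ℕ) - (M : ℤ))) : ℂ)) else 0 with hF
      have : ∀ n : Fin (2 * M + 1), (if (n : ℕ) ≤ nmax then e n * gridCoeff M h u n else 0)
          * ((√h : ℂ) * (kravchukFun n h (pt h ((j : ℕ) - (M : ℤ))) : ℂ)) = F n := by
        intro n
        simp only [hF, Finset.mem_range, Nat.lt_succ_iff]
        split_ifs <;> ring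
      rw [Finset.sum_congr rfl fun n _ => this n, ← Finset.sum_range F, Finset.sum_ite_mem,
        Finset.inter_eq_right.2 (Finset.range_subset_range.2 (by omega))]
  obtain ⟨h1, h2⟩ := norm_truncated_evolution_le hm.kravchukBasis e he m nmax (toVec M h u)
    (toVec M h r) hcoef
  rw [← hvec] at h1 h2
  refine ⟨fun hmn => ?_, ?_⟩
  · have := pow_le_pow_left₀ (norm_nonneg _) (h1 hmn) 2
    rwa [hm.norm_sq_toVec, hm.norm_sq_toVec] at this
  · have := pow_le_pow_left₀ (norm_nonneg _) h2 2
    rw [mul_pow, hm.norm_sq_toVec, hm.norm_sq_toVec] at this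
    norm_num at this ⊢
    exact this

end IsMesh

/-! ### Consistency of the Kravchuk oscillator with the harmonic oscillator -/

/-- The mean value inequality on `[0, s]` serves as integration; dropping the factor `1/(n+1)` keeps
one constant throughout the Taylor chain. -/
theorem abs_le_of_abs_deriv_le {g g' : ℝ → ℝ} (hg : ∀ s, HasDerivAt g (g' s) s) (h0 : g 0 = 0)
    {C h : ℝ} (hC : 0 ≤ C) {n : ℕ} (hb : ∀ s, 0 ≤ s → s ≤ h → |g' s| ≤ C * s ^ n) {s : ℝ}
    (hs : 0 ≤ s) (hsh : s ≤ h) : |g s| ≤ C * s ^ (n + 1) := by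
  have := Convex.norm_image_sub_le_of_norm_hasDerivWithin_le (f := g) (f' := g') (C := C * s ^ n)
    (s := Set.Icc 0 s) (x := 0) (y := s) (fun y _ => (hg y).hasDerivWithinAt)
    (fun y hy => (hb y hy.1 (hy.2.trans hsh)).trans
      (mul_le_mul_of_nonneg_left (pow_le_pow_left₀ hy.1 hy.2 n) hC))
    (convex_Icc _ _) ⟨le_rfl, hs⟩ ⟨hs, le_rfl⟩
  rw [h0, sub_zero, sub_zero, Real.norm_eq_abs, Real.norm_of_nonneg hs] at this
  rwa [pow_succ, ← mul_assoc]

/-- Taylor estimates for symmetric differences. -/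
theorem symmetric_difference_bounds {g : ℝ → ℝ} (hg : ContDiff ℝ (⊤ : ℕ∞) g) {a h B : ℝ}
    (hh : 0 ≤ h) (hB : ∀ x, |x - a| ≤ h → ∀ k ≤ 4, |iteratedDeriv k g x| ≤ B) :
    |g (a + h) - g (a - h)| ≤ 2 * B * h ∧ |g (a + h) + g (a - h) - 2 * g a| ≤ 2 * B * h ^ 2 ∧
      |g (a + h) + g (a - h) - 2 * g a - h ^ 2 * iteratedDeriv 2 g a| ≤ 2 * B * h ^ 4 := by
  have hB0 : 0 ≤ 2 * B := by
    have := (abs_nonneg _).trans (hB a (by simpa using hh) 0 (by norm_num)); linarith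
  have hd (k : ℕ) (x : ℝ) : HasDerivAt (iteratedDeriv k g) (iteratedDeriv (k + 1) g x) x := by
    rw [iteratedDeriv_succ]
    exact ((hg.differentiable_iteratedDeriv k (mod_cast ENat.natCast_lt_top k)) x).hasDerivAt
  have hp (k : ℕ) (s : ℝ) : HasDerivAt (fun s => iteratedDeriv k g (a + s))
      (iteratedDeriv (k + 1) g (a + s)) s := (hd k (a + s)).comp_const_add a s
  have hq (k : ℕ) (s : ℝ) : HasDerivAt (fun s => iteratedDeriv k g (a - s))
      (-iteratedDeriv (k + 1) g (a - s)) s := (hd k (a - s)).comp_const_sub a s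
  have hbp (k : ℕ) (hk : k ≤ 4) (s : ℝ) (hs : 0 ≤ s) (hsh : s ≤ h) :
      |iteratedDeriv k g (a + s)| ≤ B := hB _ (by rwa [add_sub_cancel_left, abs_of_nonneg hs]) k hk
  have hbq (k : ℕ) (hk : k ≤ 4) (s : ℝ) (hs : 0 ≤ s) (hsh : s ≤ h) :
      |iteratedDeriv k g (a - s)| ≤ B :=
    hB _ (by rwa [sub_sub_cancel_left, abs_neg, abs_of_nonneg hs]) k hk
  -- Each estimate bounds the derivative in `s` of the next one: `odd`, `even`, `e3`, `e4` gain the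
  -- powers `s`, `s²`, `s³`, `s⁴` in turn.
  have odd (k : ℕ) (hk : k ≤ 3) (s : ℝ) (hs : 0 ≤ s) (hsh : s ≤ h) :
      |iteratedDeriv k g (a + s) - iteratedDeriv k g (a - s)| ≤ 2 * B * s ^ 1 := by
    refine abs_le_of_abs_deriv_le (g := fun s => iteratedDeriv k g (a + s) - iteratedDeriv k g (a - s))
      (fun s => (hp k s).sub (hq k s)) (by simp) hB0 (n := 0) (h := h) (fun s hs hsh => ?_) hs hsh
    rw [pow_zero, mul_one, sub_neg_eq_add, two_mul]
    exact (abs_add_le _ _).trans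
      (add_le_add (hbp _ (by omega) s hs hsh) (hbq _ (by omega) s hs hsh))
  have even (k : ℕ) (hk : k ≤ 2) (s : ℝ) (hs : 0 ≤ s) (hsh : s ≤ h) :
      |iteratedDeriv k g (a + s) + iteratedDeriv k g (a - s) - 2 * iteratedDeriv k g a|
        ≤ 2 * B * s ^ 2 := by
    refine abs_le_of_abs_deriv_le (g := fun s => iteratedDeriv k g (a + s)
      + iteratedDeriv k g (a - s) - 2 * iteratedDeriv k g a)
      (fun s => ((hp k s).add (hq k s)).sub_const _) (by simp; ring) hB0 (n := 1) (h := h)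
      (fun s hs hsh => ?_) hs hsh
    rw [← sub_eq_add_neg]
    exact odd (k + 1) (by omega) s hs hsh
  have e3 (s : ℝ) (hs : 0 ≤ s) (hsh : s ≤ h) : |iteratedDeriv 1 g (a + s)
      - iteratedDeriv 1 g (a - s) - 2 * s * iteratedDeriv 2 g a| ≤ 2 * B * s ^ 3 := by
    refine abs_le_of_abs_deriv_le (g := fun s => iteratedDeriv 1 g (a + s)
      - iteratedDeriv 1 g (a - s) - 2 * s * iteratedDeriv 2 g a)
      (fun s => (((hp 1 s).sub (hq 1 s)).sub
        (((hasDerivAt_id s).const_mul 2).mul_const (iteratedDeriv 2 g a))))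
      (by simp) hB0 (n := 2) (h := h) (fun s hs hsh => ?_) hs hsh
    have := even 2 le_rfl s hs hsh
    rwa [sub_neg_eq_add, mul_one]
  have e4 : |iteratedDeriv 0 g (a + h) + iteratedDeriv 0 g (a - h) - 2 * iteratedDeriv 0 g a
      - h ^ 2 * iteratedDeriv 2 g a| ≤ 2 * B * h ^ 4 := by
    refine abs_le_of_abs_deriv_le (g := fun s => iteratedDeriv 0 g (a + s)
      + iteratedDeriv 0 g (a - s) - 2 * iteratedDeriv 0 g a - s ^ 2 * iteratedDeriv 2 g a)
      (fun s => ((((hp 0 s).add (hq 0 s)).sub_const _).sub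
        ((hasDerivAt_pow 2 s).mul_const (iteratedDeriv 2 g a))))
      (by simp; ring) hB0 (n := 3) (h := h) (fun s hs hsh => ?_) hh le_rfl
    have := e3 s hs hsh
    rw [← sub_eq_add_neg]
    simpa using this
  have o := odd 0 (by norm_num) h hh le_rfl
  have e := even 0 (by norm_num) h hh le_rfl
  simp only [iteratedDeriv_zero, pow_one] at o e e4
  exact ⟨o, e, e4⟩

/-- With `y = √(1+ε)` the error is exactly `-(y-1)²/2`, while `ε² = (y-1)²(y+1)²` and `y + 1 ≥ 1`.
The bound reaches down to `ε = -1`, as the edges of `A_h` require. -/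
theorem sqrt_one_add_bound {ε : ℝ} (hε : -1 ≤ ε) : |√(1 + ε) - (1 + ε / 2)| ≤ ε ^ 2 / 2 := by
  have h0 := Real.sqrt_nonneg (1 + ε)
  have h1 := Real.sq_sqrt (show 0 ≤ 1 + ε by linarith)
  set y := √(1 + ε)
  have e : ε = y ^ 2 - 1 := by linarith
  rw [e, show y - (1 + (y ^ 2 - 1) / 2) = -((y - 1) ^ 2 / 2) by ring, abs_neg,
    abs_of_nonneg (by positivity)]
  have : (y ^ 2 - 1) ^ 2 = (y - 1) ^ 2 * (y + 1) ^ 2 := by ring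
  rw [this]
  have h2 : 1 ≤ (y + 1) ^ 2 := by nlinarith
  nlinarith [mul_le_mul_of_nonneg_left h2 (sq_nonneg (y - 1))]

/-- The linear terms `± ah` cancel in the product, so it is `1 + ε` with `|ε| ≤ 2h²(1+a²)`. -/
theorem sqrt_coefficient_bound {a h : ℝ} (h0 : 0 < h) (h1 : h ≤ 1) (ha : 0 ≤ 1 - a * h)
    (ha' : 0 ≤ 1 + a * h) :
    |√((1 + a * h + h ^ 2) * (1 - a * h)) - (1 + (h ^ 2 - a ^ 2 * h ^ 2 - a * h ^ 3) / 2)|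
      ≤ 2 * h ^ 4 * (1 + a ^ 2) ^ 2 := by
  have e : (1 + a * h + h ^ 2) * (1 - a * h) = 1 + (h ^ 2 - a ^ 2 * h ^ 2 - a * h ^ 3) := by ring
  have hpos : 0 ≤ (1 + a * h + h ^ 2) * (1 - a * h) := mul_nonneg (by positivity) ha
  rw [e] at hpos ⊢
  refine (sqrt_one_add_bound (by linarith)).trans ?_
  have hε : |h ^ 2 - a ^ 2 * h ^ 2 - a * h ^ 3| ≤ 2 * h ^ 2 * (1 + a ^ 2) := by
    have h3 : |a * h ^ 3| ≤ h ^ 2 * (1 + a ^ 2) := by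
      rw [abs_mul, abs_of_pos (show 0 < h ^ 3 by positivity)]
      have : |a| ≤ 1 + a ^ 2 := by nlinarith [sq_nonneg (|a| - 1), sq_abs a, abs_nonneg a]
      calc |a| * h ^ 3 = h ^ 2 * (|a| * h) := by ring
        _ ≤ h ^ 2 * ((1 + a ^ 2) * 1) := by gcongr
        _ = _ := by ring
    have h4 : |h ^ 2 - a ^ 2 * h ^ 2| ≤ h ^ 2 * (1 + a ^ 2) := by
      rw [abs_le]; constructor <;> nlinarith [sq_nonneg h, sq_nonneg (a * h)]
    calc _ ≤ |h ^ 2 - a ^ 2 * h ^ 2| + |a * h ^ 3| := abs_sub _ _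
      _ ≤ _ := by linarith
  have := pow_le_pow_left₀ (abs_nonneg _) hε 2
  rw [sq_abs] at this
  calc _ ≤ (2 * h ^ 2 * (1 + a ^ 2)) ^ 2 / 2 := by gcongr
    _ = _ := by ring

/-- Read `p, q, z` as `g(a+h), g(a-h), g(a)`. After multiplication by `h²`, the first-order part of
the square roots reproduces the potential `a²` and cancels the zeroth-order term. What remains is
the Taylor remainder, two products of small coefficients with differences of `g`, and two
square-root errors, contributing `2 + 1 + 1 + 2 + 2 = 8`. -/
theorem consistency_algebra {a h lam B p q z s₁ s₂ : ℝ} (h0 : 0 < h) (hB0 : 0 ≤ B)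
    (ho : |p - q| ≤ 2 * B * h) (he : |p + q - 2 * z| ≤ 2 * B * h ^ 2)
    (ht : |p + q - 2 * z - h ^ 2 * ((a ^ 2 - lam) * z)| ≤ 2 * B * h ^ 4)
    (hp : |p| ≤ B) (hq : |q| ≤ B)
    (d₁ : |s₁ - (1 + (h ^ 2 - a ^ 2 * h ^ 2 - a * h ^ 3) / 2)| ≤ 2 * h ^ 4 * (1 + a ^ 2) ^ 2)
    (d₂ : |s₂ - (1 + (h ^ 2 - a ^ 2 * h ^ 2 + a * h ^ 3) / 2)| ≤ 2 * h ^ 4 * (1 + a ^ 2) ^ 2) :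
    |-(1 / h ^ 2 * s₁) * p - 1 / h ^ 2 * s₂ * q + (1 + 2 / h ^ 2) * z - lam * z|
      ≤ 8 * h ^ 2 * (B * (1 + a ^ 2) ^ 2) := by
  have key : h ^ 2 * (-(1 / h ^ 2 * s₁) * p - 1 / h ^ 2 * s₂ * q + (1 + 2 / h ^ 2) * z - lam * z)
      = -(p + q - 2 * z - h ^ 2 * ((a ^ 2 - lam) * z))
        - (h ^ 2 - a ^ 2 * h ^ 2) / 2 * (p + q - 2 * z) + a * h ^ 3 / 2 * (p - q)
        - (s₁ - (1 + (h ^ 2 - a ^ 2 * h ^ 2 - a * h ^ 3) / 2)) * p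
        - (s₂ - (1 + (h ^ 2 - a ^ 2 * h ^ 2 + a * h ^ 3) / 2)) * q := by
    have hi : h ^ 2 * (1 / h ^ 2) = 1 := by field_simp
    rw [show 2 / h ^ 2 = 2 * (1 / h ^ 2) by ring]
    linear_combination (-s₁ * p - s₂ * q + 2 * z) * hi
  generalize p + q - 2 * z - h ^ 2 * ((a ^ 2 - lam) * z) = τ at ht key
  generalize s₁ - (1 + (h ^ 2 - a ^ 2 * h ^ 2 - a * h ^ 3) / 2) = D₁ at d₁ key
  generalize s₂ - (1 + (h ^ 2 - a ^ 2 * h ^ 2 + a * h ^ 3) / 2) = D₂ at d₂ key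
  generalize p + q - 2 * z = σ at he key
  have t1 : |(h ^ 2 - a ^ 2 * h ^ 2) / 2 * σ| ≤ B * h ^ 4 * (1 + a ^ 2) := by
    rw [abs_mul]
    have : |(h ^ 2 - a ^ 2 * h ^ 2) / 2| ≤ h ^ 2 * (1 + a ^ 2) / 2 := by
      rw [abs_le]; constructor <;> nlinarith [sq_nonneg h, sq_nonneg (a * h)]
    calc _ ≤ (h ^ 2 * (1 + a ^ 2) / 2) * (2 * B * h ^ 2) := by gcongr
      _ = _ := by ring
  have t2 : |a * h ^ 3 / 2 * (p - q)| ≤ B * h ^ 4 * (1 + a ^ 2) := by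
    rw [abs_mul]
    have : |a * h ^ 3 / 2| ≤ h ^ 3 * (1 + a ^ 2) / 2 := by
      rw [abs_div, abs_mul, abs_of_pos (show 0 < h ^ 3 by positivity), abs_two, mul_comm]
      gcongr
      nlinarith [sq_nonneg (|a| - 1), sq_abs a, abs_nonneg a]
    calc _ ≤ (h ^ 3 * (1 + a ^ 2) / 2) * (2 * B * h) := by gcongr
      _ = _ := by ring
  have t3 : |D₁ * p| ≤ 2 * h ^ 4 * (1 + a ^ 2) ^ 2 * B := by rw [abs_mul]; gcongr
  have t4 : |D₂ * q| ≤ 2 * h ^ 4 * (1 + a ^ 2) ^ 2 * B := by rw [abs_mul]; gcongr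
  have hW1 : 1 + a ^ 2 ≤ (1 + a ^ 2) ^ 2 := by nlinarith [sq_nonneg a]
  have hW2 : 1 ≤ (1 + a ^ 2) ^ 2 := by nlinarith [sq_nonneg a]
  have hBh : 0 ≤ B * h ^ 4 := by positivity
  have m1 := mul_le_mul_of_nonneg_left hW1 hBh
  have m2 := mul_le_mul_of_nonneg_left hW2 hBh
  refine le_of_mul_le_mul_left ?_ (show 0 < h ^ 2 by positivity)
  rw [← abs_of_pos (show 0 < h ^ 2 by positivity), ← abs_mul,
    abs_of_pos (show 0 < h ^ 2 by positivity), key]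
  rw [abs_le] at ht t1 t2 t3 t4 ⊢
  constructor <;> linarith [ht.1, ht.2, t1.1, t1.2, t2.1, t2.2, t3.1, t3.2, t4.1, t4.2]

/-- Consistency error of the Kravchuk oscillator at an eigenfunction `g` of `-∂ₓ² + x²`. -/
theorem consistency_bound {g : ℝ → ℝ} (hg : ContDiff ℝ (⊤ : ℕ∞) g) {lam K : ℝ}
    (hK : ∀ x, ∀ k ≤ 4, (1 + x ^ 2) ^ 3 * |iteratedDeriv k g x| ≤ K)
    {a h : ℝ} (hode : iteratedDeriv 2 g a = (a ^ 2 - lam) * g a) (h0 : 0 < h) (h1 : h ≤ 1)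
    (ha : 0 ≤ 1 - a * h) (ha' : 0 ≤ 1 + a * h) :
    |-(1 / h ^ 2 * √((1 + a * h + h ^ 2) * (1 - a * h))) * g (a + h)
      - 1 / h ^ 2 * √((1 - a * h + h ^ 2) * (1 + a * h)) * g (a - h)
      + (1 + 2 / h ^ 2) * g a - lam * g a| ≤ 216 * K * h ^ 2 * (1 / (1 + a ^ 2)) := by
  -- Within distance `h ≤ 1` of `a` the weight changes by a factor at most `3`, hence `27 = 3³`. The
  -- square-root expansion spends two of the three powers of `1 + a²`, leaving one for summability
  -- over the grid; `216 = 8 · 27`.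
  set B := 27 * K / (1 + a ^ 2) ^ 3 with hBdef
  have hW : 0 < 1 + a ^ 2 := by positivity
  have hB : ∀ x, |x - a| ≤ h → ∀ k ≤ 4, |iteratedDeriv k g x| ≤ B := by
    intro x hx k hk
    have hx1 : 1 + a ^ 2 ≤ 3 * (1 + x ^ 2) := by
      have := abs_le.1 (hx.trans h1)
      nlinarith [sq_nonneg (2 * x - a)]
    rw [hBdef, le_div_iff₀ (by positivity)]
    calc |iteratedDeriv k g x| * (1 + a ^ 2) ^ 3
        ≤ |iteratedDeriv k g x| * (3 * (1 + x ^ 2)) ^ 3 := by gcongr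
      _ = 27 * ((1 + x ^ 2) ^ 3 * |iteratedDeriv k g x|) := by ring
      _ ≤ _ := by gcongr; exact hK x k hk
  obtain ⟨ho, he, ht⟩ := symmetric_difference_bounds hg h0.le hB
  have hp : |g (a + h)| ≤ B := by
    simpa using hB (a + h) (by simp [abs_of_pos h0]) 0 (by norm_num)
  have hq : |g (a - h)| ≤ B := by
    simpa using hB (a - h) (by simp [abs_of_pos h0]) 0 (by norm_num)
  rw [hode] at ht
  have d1 := sqrt_coefficient_bound h0 h1 ha ha'
  have d2 := sqrt_coefficient_bound (a := -a) h0 h1 (by linarith) (by linarith)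
  rw [show 1 + -a * h + h ^ 2 = 1 - a * h + h ^ 2 by ring, show 1 - -a * h = 1 + a * h by ring,
    neg_sq, neg_mul, sub_neg_eq_add] at d2
  refine (consistency_algebra h0 ((abs_nonneg _).trans hp) ho he ht hp hq d1 d2).trans
    (le_of_eq ?_)
  rw [hBdef]
  field_simp
  ring

/-! ### Sums over the grid -/

/-- Telescoping: with `y = 1 + nh`, the next term is at most `2/(y(y+h)) = (2/h)(1/y - 1/(y+h))`,
because `1 + (Y-1)² ≥ Y²/2`. -/
theorem sum_range_inv_one_add_sq_le {h : ℝ} (h0 : 0 < h) (n : ℕ) :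
    ∑ k ∈ Finset.range n, 1 / (1 + ((k : ℝ) * h) ^ 2) ≤ 1 + 2 / h := by
  have key (n : ℕ) : ∑ k ∈ Finset.range (n + 1), 1 / (1 + ((k : ℝ) * h) ^ 2)
      ≤ 1 + 2 / h * (1 - 1 / (1 + n * h)) := by
    induction n with
    | zero => simp
    | succ n ih =>
      rw [Finset.sum_range_succ]
      refine (add_le_add ih le_rfl).trans ?_
      have h1 : 0 < 1 + n * h := by positivity
      push_cast
      set y := 1 + n * h with hy
      have e : 1 + ((n : ℝ) + 1) * h = y + h := by rw [hy]; ring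
      have e2 : ((n : ℝ) + 1) * h = y + h - 1 := by rw [hy]; ring
      rw [e, e2]
      have e3 : 1 + 2 / h * (1 - 1 / (y + h)) = 1 + 2 / h * (1 - 1 / y) + 2 / (y * (y + h)) := by
        field_simp; ring
      rw [e3]
      refine add_le_add le_rfl ?_
      rw [div_le_div_iff₀ (by positivity) (by positivity)]
      nlinarith [sq_nonneg (y + h - 2)]
  rcases n with _ | n
  · simp only [Finset.range_zero, Finset.sum_empty]; positivity
  · refine (key n).trans ?_
    have : 0 ≤ 1 / (1 + n * h) := by positivity
    have h2 : 0 ≤ 2 / h := by positivity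
    nlinarith

theorem hasSum_grid_inv_one_add_sq {h : ℝ} (h0 : 0 < h) (h1 : h ≤ 1) :
    Summable (fun a : Grid h => 1 / (1 + (a : ℝ) ^ 2)) ∧
      h * ∑' a : Grid h, 1 / (1 + (a : ℝ) ^ 2) ≤ 6 := by
  set f : ℤ → ℝ := fun k => 1 / (1 + ((k : ℝ) * h) ^ 2) with hf
  have hnn (n : ℕ) : 0 ≤ 1 / (1 + ((n : ℝ) * h) ^ 2) := by positivity
  have hs1 : Summable fun n : ℕ => 1 / (1 + ((n : ℝ) * h) ^ 2) :=
    summable_of_sum_range_le hnn (sum_range_inv_one_add_sq_le h0)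
  have ht1 : ∑' n : ℕ, 1 / (1 + ((n : ℝ) * h) ^ 2) ≤ 1 + 2 / h :=
    Real.tsum_le_of_sum_range_le hnn (sum_range_inv_one_add_sq_le h0)
  have e1 (n : ℕ) : f n = 1 / (1 + ((n : ℝ) * h) ^ 2) := by simp [hf]
  have e2 (n : ℕ) : f (-((n : ℤ) + 1)) = 1 / (1 + (((n + 1 : ℕ) : ℝ) * h) ^ 2) := by
    simp only [hf]; push_cast; ring_nf
  have hs2 : Summable fun n : ℕ => 1 / (1 + (((n + 1 : ℕ) : ℝ) * h) ^ 2) :=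
    (summable_nat_add_iff 1).2 hs1
  have ht2 : ∑' n : ℕ, 1 / (1 + (((n + 1 : ℕ) : ℝ) * h) ^ 2) ≤ 1 + 2 / h := by
    refine le_trans ?_ ht1
    rw [hs1.tsum_eq_zero_add]
    exact le_add_of_nonneg_left (by positivity)
  have hS : HasSum f (∑' n : ℕ, 1 / (1 + ((n : ℝ) * h) ^ 2)
      + ∑' n : ℕ, 1 / (1 + (((n + 1 : ℕ) : ℝ) * h) ^ 2)) := by
    refine HasSum.of_nat_of_neg_add_one ?_ ?_
    · simpa only [e1] using hs1.hasSum
    · simpa only [e2] using hs2.hasSum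
  let E : ℤ ≃ Grid h := Equiv.ofBijective (pt h) ⟨pt_injective h0, pt_surjective h⟩
  have hG : HasSum (fun a : Grid h => 1 / (1 + (a : ℝ) ^ 2)) _ := (E.hasSum_iff).1 hS
  refine ⟨hG.summable, ?_⟩
  rw [hG.tsum_eq]
  have : h * (1 + 2 / h + (1 + 2 / h)) = 2 * h + 4 := by field_simp; ring
  nlinarith

/-- Minkowski for infinite sums: the series converges absolutely in the complete space `ℓ²`, and
continuity of point evaluations identifies its sum with the pointwise limit `D`. -/
theorem ell2Norm_le_of_hasSum {h : ℝ} (h0 : 0 < h) {E : ℕ → Grid h → ℂ} {D : Grid h → ℂ} {B : ℕ → ℝ}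
    (hs : ∀ m, MemEll2 h (E m)) (hB : ∀ m, ell2Norm h (E m) ≤ B m) (hBs : Summable B)
    (hD : ∀ a, HasSum (fun m => E m a) (D a)) : MemEll2 h D ∧ ell2Norm h D ≤ ∑' m, B m := by
  have h2 : (2 : ENNReal).toReal = 2 := by norm_num
  have hnorm (x : lp (fun _ : Grid h => ℂ) 2) : ‖x‖ ^ 2 = ∑' a, ‖x a‖ ^ 2 := by
    have := lp.norm_rpow_eq_tsum (p := 2) (by norm_num) x
    simpa [h2] using this
  have hmem (u : Grid h → ℂ) : Memℓp u 2 ↔ MemEll2 h u := by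
    rw [memℓp_gen_iff (by norm_num)]
    simp [MemEll2]
  have hell (x : lp (fun _ : Grid h => ℂ) 2) : ell2Norm h x = √h * ‖x‖ := by
    rw [ell2Norm, ← hnorm, Real.sqrt_mul h0.le, Real.sqrt_sq (norm_nonneg _)]
  set e : ℕ → lp (fun _ : Grid h => ℂ) 2 := fun m => ⟨E m, (hmem _).2 (hs m)⟩ with he
  have hsq : 0 < √h := by positivity
  have heB (m : ℕ) : ‖e m‖ ≤ B m / √h := by
    rw [le_div_iff₀ hsq, mul_comm, ← hell]
    exact hB m
  have hsum : Summable e := Summable.of_norm_bounded (hBs.div_const _) heB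
  have hx : (fun a => (∑' m, e m : lp (fun _ : Grid h => ℂ) 2) a) = D := by
    ext a
    let ev : lp (fun _ : Grid h => ℂ) 2 →+ ℂ :=
      { toFun := fun x => x a, map_zero' := rfl, map_add' := fun _ _ => rfl }
    have hc : Continuous ev := (lp.lipschitzWith_one_eval 2 a).continuous
    exact (hsum.hasSum.map ev hc).unique (hD a)
  have hx' : ((∑' m, e m : lp (fun _ : Grid h => ℂ) 2) : Grid h → ℂ) = D := hx
  rw [← hx']
  refine ⟨(hmem _).1 (lp.memℓp _), ?_⟩
  rw [hell]
  have := tsum_of_norm_bounded (hBs.div_const (√h)).hasSum heB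
  rw [tsum_div_const, le_div_iff₀ hsq, mul_comm] at this
  exact this

/-! ### The error of a single Hermite mode. -/

namespace IsMesh

variable {M : ℕ} {h : ℝ}

theorem exists_index (hm : IsMesh M h) {a : Grid h} (ha : InA h a) :
    ∃ j ∈ Finset.range (2 * M + 1), pt h ((j : ℤ) - M) = a := by
  obtain ⟨k, rfl⟩ := pt_surjective h a
  have hk := (hm.inA_pt_iff k).1 ha
  obtain ⟨j, hj⟩ := Int.eq_ofNat_of_zero_le (show 0 ≤ k + M by omega)
  exact ⟨j, Finset.mem_range.2 (by omega), by congr 1; omega⟩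

theorem index_injective (hm : IsMesh M h) : Function.Injective fun j : ℕ => pt h ((j : ℤ) - M) := by
  intro i j hij
  have := pt_injective hm.pos hij
  omega

theorem hasSum_of_support {E : Type*} [AddCommMonoid E] [TopologicalSpace E] (hm : IsMesh M h)
    {F : Grid h → E} (hF : ∀ a, ¬ InA h a → F a = 0) :
    HasSum F (∑ j ∈ Finset.range (2 * M + 1), F (pt h ((j : ℤ) - M))) := by
  have := hasSum_sum_of_ne_finset_zero (f := F)
    (s := (Finset.range (2 * M + 1)).map ⟨_, hm.index_injective⟩) (L := SummationFilter.unconditional _)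
    (fun a ha => hF a fun hA => ha (by
      obtain ⟨j, hj, rfl⟩ := hm.exists_index hA
      exact Finset.mem_map.2 ⟨j, hj, rfl⟩))
  rwa [Finset.sum_map] at this

theorem sum_weight_le (hm : IsMesh M h) (h1 : h ≤ 1) :
    h * ∑ j ∈ Finset.range (2 * M + 1), 1 / (1 + ((pt h ((j : ℤ) - M) : Grid h) : ℝ) ^ 2) ≤ 6 := by
  obtain ⟨hs, ht⟩ := hasSum_grid_inv_one_add_sq hm.pos h1
  refine le_trans (mul_le_mul_of_nonneg_left ?_ hm.pos.le) ht
  have := hs.sum_le_tsum ((Finset.range (2 * M + 1)).map ⟨_, hm.index_injective⟩)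
    (fun a _ => by positivity)
  rwa [Finset.sum_map] at this

theorem kravchukCoeff_eq (hm : IsMesh M h) (f : ℝ → ℂ) (n : ℕ) :
    kravchukCoeff f n h = gridCoeff M h (restrict h f) n := by
  rw [kravchukCoeff, gridCoeff, (hm.hasSum_of_support (fun a ha => by rw [if_neg ha, zero_mul])).tsum_eq]
  congr 1
  refine Finset.sum_congr rfl fun j hj => ?_
  have := Finset.mem_range.1 hj
  rw [if_pos ((hm.inA_pt_iff _).2 (by omega))]

theorem kravchukFun_of_notMem {a : Grid h} (ha : ¬ InA h a) (n : ℕ) : kravchukFun n h a = 0 := by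
  rw [kravchukFun, rho_of_notMem ha, Real.sqrt_zero, mul_zero]

/-- The difference between the exact and the truncated discrete evolution of `ψ_m`. -/
noncomputable def modeError (M : ℕ) (h : ℝ) (e : ℕ → ℂ) (nmax m : ℕ) (a : Grid h) : ℂ :=
  e m * (hermiteFun m a : ℂ) - ∑ n ∈ Finset.range (nmax + 1),
    gridCoeff M h (fun b => (hermiteFun m b : ℂ)) n * e n * (kravchukFun n h a : ℂ)

theorem oscillator_hermiteFun_bound (hm : IsMesh M h) (h1 : h ≤ 1) {K : ℝ} {m : ℕ}
    (hK : ∀ x, ∀ k ≤ 4, (1 + x ^ 2) ^ 3 * |iteratedDeriv k (hermiteFun m) x| ≤ K)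
    {a : Grid h} (ha : InA h a) :
    ‖kravchukOscillator h (fun b => (hermiteFun m b : ℂ)) a - (2 * m + 1) * (hermiteFun m a : ℂ)‖
      ≤ 216 * K * h ^ 2 * (1 / (1 + (a : ℝ) ^ 2)) := by
  have h0 := hm.pos
  have ha' := ha
  rw [InA, Set.mem_Icc, neg_le, le_div_iff₀ h0, le_div_iff₀ h0] at ha'
  have hode : iteratedDeriv 2 (hermiteFun m) a = ((a : ℝ) ^ 2 - (2 * m + 1)) * hermiteFun m a := by
    rw [iteratedDeriv_succ, iteratedDeriv_one, (hasDerivAt_deriv_hermiteFun m a).deriv]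
  have hc := consistency_bound (contDiff_hermiteFun m) hK hode h0 h1 (by linarith [ha'.2])
    (by linarith [ha'.1])
  refine le_trans (le_of_eq ?_) hc
  rw [kravchukOscillator, if_pos ha, ← Real.norm_eq_abs, ← Complex.norm_real]
  congr 1
  push_cast [Grid.step]
  rfl

/-- The spectral-gap estimate controls the part on `A_h`, the decay of `ψ_m` the part outside. With
`c` the last factor, the squares add up to `6·216² + 6 ≤ 600²` times `(K c)²`. -/
theorem modeError_bound (hm : IsMesh M h) (h1 : h ≤ 1) {K : ℝ} {m nmax : ℕ} (hn : nmax ≤ 2 * M)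
    (hK : ∀ x, ∀ k ≤ 4, (1 + x ^ 2) ^ 3 * |iteratedDeriv k (hermiteFun m) x| ≤ K)
    {e : ℕ → ℂ} (he : ∀ n, ‖e n‖ = 1) :
    MemEll2 h (modeError M h e nmax m) ∧
      ell2Norm h (modeError M h e nmax m) ≤ 600 * K * (if m ≤ nmax then h ^ 2 else 1) := by
  classical
  have h0 := hm.pos
  have hK0 : 0 ≤ K := le_trans (by positivity) (hK 0 0 (by norm_num))
  set E := modeError M h e nmax m with hE
  have hψ (x : ℝ) : |hermiteFun m x| ≤ K * (1 / (1 + x ^ 2)) * (1 / (1 + x ^ 2)) := by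
    have := hK x 0 (by norm_num)
    rw [iteratedDeriv_zero] at this
    have hx : 0 < 1 + x ^ 2 := by positivity
    have hx1 : 1 ≤ 1 + x ^ 2 := by nlinarith [sq_nonneg x]
    rw [mul_one_div, mul_one_div, div_div, le_div_iff₀ (by positivity)]
    refine le_trans ?_ this
    rw [mul_comm]
    gcongr
    calc (1 + x ^ 2) * (1 + x ^ 2) = (1 + x ^ 2) ^ 2 := by ring
      _ ≤ _ := pow_le_pow_right₀ hx1 (by norm_num)
  have hw (x : ℝ) : 0 ≤ 1 / (1 + x ^ 2) ∧ 1 / (1 + x ^ 2) ≤ 1 := by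
    refine ⟨by positivity, ?_⟩
    rw [div_le_one (by positivity)]; nlinarith [sq_nonneg x]
  set c : ℝ := if m ≤ nmax then h ^ 2 else 1 with hc
  have hc0 : 0 ≤ c := by rw [hc]; split_ifs <;> positivity
  have hhc : h ^ 2 ≤ c := by
    rw [hc]; split_ifs
    · exact le_rfl
    · nlinarith
  have hsq {x L : ℝ} {y : ℝ} (hx : 0 ≤ x) (hL : x ≤ L * (1 / (1 + y ^ 2))) :
      x ^ 2 ≤ L ^ 2 * (1 / (1 + y ^ 2)) := by
    have h3 := pow_le_pow_left₀ hx hL 2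
    rw [mul_pow] at h3
    refine h3.trans (mul_le_mul_of_nonneg_left ?_ (sq_nonneg L))
    nlinarith [hw y]
  have hsumle {u : Grid h → ℝ} {L : ℝ} (hu : ∀ a, InA h a → u a ^ 2 ≤ L ^ 2 * (1 / (1 + (a : ℝ) ^ 2))) :
      h * ∑ j ∈ Finset.range (2 * M + 1), u (pt h ((j : ℤ) - M)) ^ 2 ≤ 6 * L ^ 2 := by
    calc _ ≤ h * ∑ j ∈ Finset.range (2 * M + 1),
          L ^ 2 * (1 / (1 + ((pt h ((j : ℤ) - M) : Grid h) : ℝ) ^ 2)) := by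
          refine mul_le_mul_of_nonneg_left (Finset.sum_le_sum fun j hj => hu _ ?_) h0.le
          have := Finset.mem_range.1 hj
          exact (hm.inA_pt_iff _).2 (by omega)
      _ = L ^ 2 * (h * ∑ j ∈ Finset.range (2 * M + 1),
          1 / (1 + ((pt h ((j : ℤ) - M) : Grid h) : ℝ) ^ 2)) := by
          rw [← Finset.mul_sum]; ring
      _ ≤ _ := by
          rw [mul_comm 6]
          exact mul_le_mul_of_nonneg_left (hm.sum_weight_le h1) (sq_nonneg L)
  obtain ⟨b1, b2⟩ := hm.truncation_error_le (fun b => (hermiteFun m b : ℂ)) e he m nmax hn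
  have hin : h * ∑ j ∈ Finset.range (2 * M + 1), ‖E (pt h ((j : ℤ) - M))‖ ^ 2
      ≤ 6 * (216 * K * c) ^ 2 := by
    by_cases hmn : m ≤ nmax
    · refine (b1 hmn).trans ?_
      refine hsumle (u := fun a => ‖kravchukOscillator h (fun b => (hermiteFun m b : ℂ)) a
        - (2 * m + 1) * (hermiteFun m a : ℂ)‖) fun a ha => hsq (norm_nonneg _) ?_
      rw [hc, if_pos hmn]
      exact hm.oscillator_hermiteFun_bound h1 hK ha
    · refine b2.trans ?_
      have := hsumle (u := fun a => ‖(hermiteFun m a : ℂ)‖) (L := K)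
        fun a _ => hsq (norm_nonneg _) (by
          rw [Complex.norm_real]
          refine (hψ a).trans ?_
          exact mul_le_of_le_one_right (mul_nonneg hK0 (hw _).1) (hw _).2)
      rw [hc, if_neg hmn]
      nlinarith [sq_nonneg K]
  -- Off `A_h` all `φ_n` vanish and `|a| > 1/h`. One factor `1/(1+a²)` of the bound on `ψ_m` is
  -- traded for `h²`; the other keeps the sum finite.
  have hout (a : Grid h) (ha : ¬ InA h a) : ‖E a‖ ^ 2 ≤ (K * c) ^ 2 * (1 / (1 + (a : ℝ) ^ 2)) := by
    refine hsq (norm_nonneg _) ?_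
    have e1 : E a = e m * (hermiteFun m a : ℂ) := by
      rw [hE, modeError, Finset.sum_eq_zero, sub_zero]
      intro n _
      rw [kravchukFun_of_notMem ha]; simp
    rw [e1, norm_mul, he, one_mul, Complex.norm_real]
    refine (hψ a).trans ?_
    have ha2 : 1 / (1 + (a : ℝ) ^ 2) ≤ h ^ 2 := by
      rw [InA, Set.mem_Icc, ← abs_le, not_le] at ha
      have h3 := pow_le_pow_left₀ (by positivity) ha.le 2
      rw [sq_abs, div_pow, one_pow, div_le_iff₀ (by positivity)] at h3
      rw [div_le_iff₀ (by positivity)]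
      nlinarith [sq_nonneg h]
    have := hw (a : ℝ)
    calc _ ≤ K * c * (1 / (1 + (a : ℝ) ^ 2)) := by
          refine mul_le_mul_of_nonneg_right ?_ this.1
          exact mul_le_mul_of_nonneg_left (ha2.trans hhc) hK0
      _ = _ := rfl
  obtain ⟨hsw, htw⟩ := hasSum_grid_inv_one_add_sq h0 h1
  set F₁ : Grid h → ℝ := fun a => if InA h a then ‖E a‖ ^ 2 else 0 with hF₁
  set F₂ : Grid h → ℝ := fun a => if InA h a then 0 else ‖E a‖ ^ 2 with hF₂
  have hs1 := hm.hasSum_of_support (F := F₁) (fun a ha => if_neg ha)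
  have hle (a : Grid h) : F₂ a ≤ (K * c) ^ 2 * (1 / (1 + (a : ℝ) ^ 2)) := by
    simp only [hF₂]
    split_ifs with ha
    · positivity
    · exact hout a ha
  have hs2 : Summable F₂ := by
    refine Summable.of_nonneg_of_le (fun a => ?_) hle (hsw.mul_left _)
    simp only [hF₂]; split_ifs <;> positivity
  have ht2 : h * ∑' a, F₂ a ≤ 6 * (K * c) ^ 2 := by
    have := hs2.tsum_le_tsum hle (hsw.mul_left _)
    rw [tsum_mul_left] at this
    calc _ ≤ h * ((K * c) ^ 2 * ∑' a : Grid h, 1 / (1 + (a : ℝ) ^ 2)) :=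
          mul_le_mul_of_nonneg_left this h0.le
      _ = (K * c) ^ 2 * (h * ∑' a : Grid h, 1 / (1 + (a : ℝ) ^ 2)) := by ring
      _ ≤ (K * c) ^ 2 * 6 := mul_le_mul_of_nonneg_left htw (sq_nonneg _)
      _ = _ := by ring
  have hF (a : Grid h) : ‖E a‖ ^ 2 = F₁ a + F₂ a := by
    simp only [hF₁, hF₂]; split_ifs <;> simp
  have hsum := hs1.add hs2.hasSum
  rw [← funext hF] at hsum
  refine ⟨hsum.summable, ?_⟩
  rw [ell2Norm, hsum.tsum_eq]
  refine Real.sqrt_le_iff.2 ⟨by positivity, ?_⟩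
  have e3 : ∑ j ∈ Finset.range (2 * M + 1), F₁ (pt h ((j : ℤ) - M))
      = ∑ j ∈ Finset.range (2 * M + 1), ‖E (pt h ((j : ℤ) - M))‖ ^ 2 := by
    refine Finset.sum_congr rfl fun j hj => ?_
    have := Finset.mem_range.1 hj
    simp only [hF₁]
    rw [if_pos ((hm.inA_pt_iff _).2 (by omega))]
  rw [e3, mul_add]
  nlinarith [sq_nonneg (K * c)]

end IsMesh

/-- Error of the truncated Kravchuk evolution: second order in `h`, spectral in the cutoff. -/
theorem evolution_error (f : 𝓢(ℝ, ℂ)) : ∃ A₀ : ℝ, ∀ σ : ℕ, ∃ A : ℝ, 0 ≤ A ∧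
    ∀ (M : ℕ) (h : ℝ), IsMesh M h → h ≤ 1 → ∀ nmax : ℕ, nmax ≤ 2 * M → ∀ t : ℝ,
      MemEll2 h (fun a => restrict h (evolution f t) a - discreteEvolution f nmax h t a) ∧
      ell2Norm h (fun a => restrict h (evolution f t) a - discreteEvolution f nmax h t a)
        ≤ A₀ * h ^ 2 + A / ((nmax : ℝ) + 1) ^ σ := by
  obtain ⟨C, p, hC, hbd⟩ := exists_hermiteFun_weighted_bound
  refine ⟨600 * C * ∑' m, ‖hermiteCoeff f m‖ * ((m : ℝ) + 1) ^ p, fun σ =>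
    ⟨600 * C * ∑' m, ‖hermiteCoeff f m‖ * ((m : ℝ) + 1) ^ (p + σ), by positivity, ?_⟩⟩
  intro M h hm h1 nmax hn t
  have h0 := hm.pos
  set e : ℕ → ℂ := fun n => Complex.exp (-Complex.I * (2 * n + 1) * t) with he
  have he1 (n : ℕ) : ‖e n‖ = 1 := by
    simp only [he]
    rw [show -Complex.I * (2 * n + 1) * t = ((-(2 * n + 1) * t : ℝ) : ℂ) * Complex.I by
      push_cast; ring]
    exact Complex.norm_exp_ofReal_mul_I _
  have hS1 := summable_hermiteCoeff f p
  have hS2 := summable_hermiteCoeff f (p + σ)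
  -- The first term covers `m ≤ nmax`. The second covers `m > nmax`, where `1 ≤ ((m+1)/(nmax+1))^σ`
  -- and the coefficient decay pays for the extra power of `m + 1`.
  set B : ℕ → ℝ := fun m => 600 * C * h ^ 2 * (‖hermiteCoeff f m‖ * ((m : ℝ) + 1) ^ p)
    + 600 * C / ((nmax : ℝ) + 1) ^ σ * (‖hermiteCoeff f m‖ * ((m : ℝ) + 1) ^ (p + σ)) with hB
  have hBs : HasSum B _ := (hS1.hasSum.mul_left _).add (hS2.hasSum.mul_left _)
  have hmode (m : ℕ) := hm.modeError_bound h1 hn (hbd m) he1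
  have hD (a : Grid h) : HasSum (fun m => hermiteCoeff f m * IsMesh.modeError M h e nmax m a)
      (restrict h (evolution f t) a - discreteEvolution f nmax h t a) := by
    -- Pairing with `φ_n` is a finite sum over `A_h`, so pointwise convergence of the Hermite
    -- expansion suffices to expand the discrete coefficient mode by mode.
    have hcoef (n : ℕ) : HasSum (fun m => hermiteCoeff f m
        * IsMesh.gridCoeff M h (fun b => (hermiteFun m b : ℂ)) n) (kravchukCoeff f n h) := by
      rw [hm.kravchukCoeff_eq]
      have : HasSum (fun m => (h : ℂ) * ∑ j ∈ Finset.range (2 * M + 1),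
          hermiteCoeff f m * (hermiteFun m (pt h ((j : ℤ) - M)) : ℂ)
            * (kravchukFun n h (pt h ((j : ℤ) - M)) : ℂ))
          (IsMesh.gridCoeff M h (restrict h f) n) :=
        (hasSum_sum fun j _ => (hasSum_hermite_expansion f _).mul_right _).mul_left _
      refine this.congr_fun ?_
      intro m
      rw [IsMesh.gridCoeff, mul_left_comm, Finset.mul_sum]
      simp only [mul_assoc]
    have h3 := (summable_evolutionTerm f t a).hasSum.sub
      (hasSum_sum (s := Finset.range (nmax + 1)) fun n _ =>
        ((hcoef n).mul_right (e n)).mul_right (kravchukFun n h a : ℂ))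
    refine h3.congr_fun ?_
    intro m
    rw [IsMesh.modeError, evolutionTerm, mul_sub, Finset.mul_sum]
    congr 1
    · simp only [he]; ring
    · exact Finset.sum_congr rfl fun n _ => by ring
  have hscale (m : ℕ) : ell2Norm h (fun a => hermiteCoeff f m * IsMesh.modeError M h e nmax m a)
      = ‖hermiteCoeff f m‖ * ell2Norm h (IsMesh.modeError M h e nmax m) := by
    simp only [ell2Norm, norm_mul, mul_pow]
    rw [tsum_mul_left, mul_left_comm, Real.sqrt_mul (sq_nonneg _), Real.sqrt_sq (norm_nonneg _)]
  have key := ell2Norm_le_of_hasSum h0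
    (E := fun m a => hermiteCoeff f m * IsMesh.modeError M h e nmax m a) (B := B)
    (fun m => by
      simp only [MemEll2, norm_mul, mul_pow]
      exact (hmode m).1.mul_left _)
    (fun m => by
      rw [hscale]
      refine (mul_le_mul_of_nonneg_left (hmode m).2 (norm_nonneg _)).trans ?_
      simp only [hB]
      split_ifs with hmn
      · refine le_trans (le_of_eq ?_) (le_add_of_nonneg_right (by positivity))
        ring
      · refine le_trans ?_ (le_add_of_nonneg_left (by positivity))
        have hlt : ((nmax : ℝ) + 1) ^ σ ≤ ((m : ℝ) + 1) ^ σ := by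
          gcongr; exact_mod_cast (not_le.1 hmn).le
        have : 600 * C / ((nmax : ℝ) + 1) ^ σ * (‖hermiteCoeff f m‖ * ((m : ℝ) + 1) ^ (p + σ))
            = (600 * C * ‖hermiteCoeff f m‖ * ((m : ℝ) + 1) ^ p)
              * (((m : ℝ) + 1) ^ σ / ((nmax : ℝ) + 1) ^ σ) := by
          rw [pow_add]; ring
        rw [this]
        refine le_trans (le_of_eq ?_) (le_mul_of_one_le_right (by positivity)
          ((one_le_div (by positivity)).2 hlt))
        ring)
    hBs.summable hD
  refine ⟨key.1, key.2.trans (le_of_eq ?_)⟩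
  rw [hBs.tsum_eq]
  ring

/-! ### From the mesh estimate to the asymptotic statement. -/

theorem IsMesh.of_eq {N : ℕ} {h : ℝ} (hN : 0 < N) (hev : Even N)
    (hh : h = √2 * (N : ℝ) ^ (-(1 / 2) : ℝ)) : ∃ M : ℕ, N = 2 * M ∧ IsMesh M h := by
  obtain ⟨M, hM⟩ := hev
  have hN' : (0 : ℝ) < N := by exact_mod_cast hN
  refine ⟨M, by omega, by rw [hh]; positivity, ?_⟩
  rw [hh, mul_pow, Real.sq_sqrt (by norm_num), ← Real.rpow_natCast, ← Real.rpow_mul hN'.le]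
  norm_num
  rw [Real.rpow_neg_one]
  have : (N : ℝ) = M + M := by exact_mod_cast hM
  rw [this] at hN' ⊢
  have hM0 : (M : ℝ) ≠ 0 := by linarith
  field_simp
  norm_num

end Kravchuk

open Kravchuk in
theorem theorem4 (f : ℝ → ℂ) (hf : Kravchuk.IsSmooth f) :
    (∀ t x : ℝ, Summable (Kravchuk.evolutionTerm f t x)) ∧
    ∃ C : ℝ, ∀ s : ℝ, ∃ Cs : ℝ, ∀ δ : ℝ, 0 < δ → ∃ h₀ : ℝ, 0 < h₀ ∧
      ∀ (N : ℕ) (h : ℝ), 0 < N → Even N → h = √2 * (N : ℝ) ^ (-(1 / 2) : ℝ) → h < h₀ →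
      ∀ nmax : ℕ, 1 / 4 * δ * |Real.log h| ≤ nmax → (nmax : ℝ) ≤ 1 / 3 * δ * |Real.log h| →
        Kravchuk.SolvesDiscreteSchrodinger h (Kravchuk.discreteEvolution f nmax h) ∧
        ∀ t : ℝ, 0 ≤ t →
          Kravchuk.MemEll2 h (fun a => Kravchuk.restrict h (Kravchuk.evolution f t) a
            - Kravchuk.discreteEvolution f nmax h t a) ∧
          Kravchuk.ell2Norm h (fun a => Kravchuk.restrict h (Kravchuk.evolution f t) a
            - Kravchuk.discreteEvolution f nmax h t a)
            ≤ C * h ^ (2 - δ) + Cs / |Real.log h| ^ s := by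
  obtain ⟨F, rfl⟩ := hf.exists_schwartz
  -- Both constants can be `1`: the threshold on `h` may depend on `f`, `s` and `δ`, and `h^δ` and a
  -- spare power of `|log h|` absorb the true constants.
  refine ⟨fun t x => summable_evolutionTerm F t x, 1, fun s => ⟨1, fun δ hδ => ?_⟩⟩
  obtain ⟨A₀, hA₀⟩ := evolution_error F
  -- The extra `1` is the spare power of `|log h|` that absorbs `A (4/δ)^σ`; the natural ceiling
  -- also covers negative `s`.
  set σ : ℕ := ⌈s⌉₊ + 1 with hσ
  obtain ⟨A, hA, herr⟩ := hA₀ σ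
  have hsσ : s + 1 ≤ σ := by
    rw [hσ]; push_cast; linarith [Nat.le_ceil s]
  have ev1 : ∀ᶠ h : ℝ in nhdsWithin 0 (Set.Ioi 0), A₀ * h ^ δ < 1 := by
    have : Filter.Tendsto (fun h : ℝ => A₀ * h ^ δ) (nhdsWithin 0 (Set.Ioi 0)) (nhds (A₀ * 0)) := by
      refine Filter.Tendsto.const_mul _ ?_
      have := (Real.continuousAt_rpow_const 0 δ (Or.inr hδ.le)).tendsto
      rw [Real.zero_rpow hδ.ne'] at this
      exact this.mono_left nhdsWithin_le_nhds
    rw [mul_zero] at this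
    exact this.eventually_lt_const one_pos
  have ev2 : ∀ᶠ h : ℝ in nhdsWithin 0 (Set.Ioi 0), A * (4 / δ) ^ σ + 1 ≤ -Real.log h :=
    (Filter.tendsto_neg_atBot_atTop.comp Real.tendsto_log_nhdsGT_zero).eventually_ge_atTop _
  -- The bound `6/δ` ensures `nmax ≤ 2M`: from `|log h| ≤ 1/h` follows `nmax ≤ (hδ/3)/h² ≤ 2/h²`.
  have ev3 : ∀ᶠ h : ℝ in nhdsWithin 0 (Set.Ioi 0), h < min 1 (6 / δ) :=
    (eventually_lt_nhds (by positivity)).filter_mono nhdsWithin_le_nhds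
  obtain ⟨h₀, hh₀, hsub⟩ := mem_nhdsGT_iff_exists_Ioo_subset.1 (ev1.and (ev2.and ev3))
  refine ⟨h₀, hh₀, fun N h hN hev hh hlt nmax hlow hup => ?_⟩
  obtain ⟨M, rfl, hm⟩ := IsMesh.of_eq hN hev hh
  have h0 := hm.pos
  obtain ⟨e1, e2, e3⟩ := hsub ⟨h0, hlt⟩
  have h1 : h < 1 := e3.trans_le (min_le_left _ _)
  have h6 : h < 6 / δ := e3.trans_le (min_le_right _ _)
  have hlog : |Real.log h| = -Real.log h := abs_of_neg (Real.log_neg h0 h1)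
  set L := |Real.log h| with hL
  rw [← hlog] at e2
  have hL1 : 1 ≤ L := by linarith [show 0 ≤ A * (4 / δ) ^ σ by positivity]
  have hLA : A * (4 / δ) ^ σ ≤ L := by linarith
  have hL0 : 0 < L := by linarith
  have hnM : nmax ≤ 2 * M := by
    have hLh : L ≤ 1 / h := by
      rw [hlog, ← Real.log_inv, ← one_div]
      exact (Real.log_le_sub_one_of_pos (by positivity)).trans (by linarith)
    have h7 : (nmax : ℝ) ≤ 2 / h ^ 2 := by
      refine hup.trans ?_
      rw [lt_div_iff₀ hδ] at h6
      calc 1 / 3 * δ * L ≤ 1 / 3 * δ * (1 / h) := by gcongr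
        _ = (h * δ) / 3 / h ^ 2 := by field_simp
        _ ≤ _ := by gcongr; linarith
    rw [hm.two_div_sq] at h7
    exact_mod_cast h7
  refine ⟨hm.solves F nmax, fun t _ => ?_⟩
  obtain ⟨r1, r2⟩ := herr M h hm h1.le nmax hnM t
  refine ⟨r1, r2.trans ?_⟩
  rw [one_mul]
  refine add_le_add ?_ ?_
  · have : h ^ 2 = h ^ δ * h ^ (2 - δ) := by
      rw [← Real.rpow_add h0, ← Real.rpow_natCast]; congr 1; push_cast; ring
    rw [this, ← mul_assoc]
    exact mul_le_of_le_one_left (by positivity) e1.le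
  · have hn1 : δ / 4 * L ≤ (nmax : ℝ) + 1 := by linarith
    calc A / ((nmax : ℝ) + 1) ^ σ ≤ A / (δ / 4 * L) ^ σ := by gcongr
      _ = (A * (4 / δ) ^ σ) / L ^ σ := by
        rw [mul_pow, div_pow, div_pow]; field_simp
      _ ≤ L / L ^ σ := by gcongr
      _ = 1 / L ^ ((σ : ℝ) - 1) := by
        rw [Real.rpow_sub_one hL0.ne', Real.rpow_natCast]; field_simp
      _ ≤ 1 / L ^ s := by
        gcongr
        linarith
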